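/- Let $V$ be real-valued and absolutely continuous on $[0,\pi]$, and let $a\in(0,\pi)$. For $z\in\mathbb C$ let $\xi(\cdot,z)$ be the solution on $[0,\pi]$ of $-\xi''+V\xi=z\xi$, $\xi(0,z)=1$, $\xi'(0,z)=0$. Write $\langle u,v\rangle_s=\int_0^s\overline{u(x)}\,v(x)\,dx$, and let $$\mathcal B_a=\Big\{f:\mathbb C\to\mathbb C \;:\; f(z)=\langle \xi(\cdot,\overline z),\varphi\rangle_a \text{ for all } z\in\mathbb C,\ \text{for some }\varphi\in L_2(0,a)\Big\}.$$ Let $H$ be the selfadjoint operator $\varphi\mapsto-\varphi''+V\varphi$ in $L_2(0,\pi)$ whose domain consists of all $\varphi\in L_2(0,\pi)$ with $\varphi,\varphi'$ absolutely continuous on $[0,\pi]$, $-\varphi''+V\varphi\in L_2(0,\pi)$ and $\varphi'(0)=\varphi'(\pi)=0$, and let $\sigma(H)$ be its spectrum. Let $\mathcal R(x)=1$ for $x\in[0,a]$ and $\mathcal R(x)=\frac{\pi-x}{\pi-a}$ for $x\in(a,\pi]$. With $k_\pi(z,w)=\langle\xi(\cdot,\overline z),\xi(\cdot,\overline w)\rangle_\pi$,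 put $$\widetilde{\mathcal K}_{a\pi}(z,t)=\frac{1}{k_\pi(t,t)}\,\big\langle \xi(\cdot,\overline z),\,\mathcal R(\cdot)\,\xi(\cdot,t)\big\rangle_\pi,\qquad z\in\mathbb C,\ t\in\sigma(H).$$ Then for every compact set $K\subset\mathbb C$ there is a constant $C=C(a,K,V)>0$ such that, for every $f\in\mathcal B_a$ and every bounded family $\epsilon=\{\epsilon_t\}_{t\in\sigma(H)}$ of complex (in particular, real) numbers, the series $$\widetilde f(z)=\sum_{t\in\sigma(H)}\widetilde{\mathcal K}_{a\pi}(z,t)\,\big(f(t)+\epsilon_t\big)$$ converges (unconditionally) uniformly on $K$, and $$|f(z)-\widetilde f(z)|\le C\,\|\epsilon\|_\infty,\qquad z\in K.$$ -/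

import Mathlib

open MeasureTheory Set Filter Topology
open scoped ComplexConjugate ENNReal

noncomputable section

/-- The Hilbert space `L²(0,s)` of complex-valued functions. -/
abbrev L2Space (s : ℝ) : Type := Lp ℂ 2 (volume.restrict (Ioo (0 : ℝ) s))

/-- The inner product of `L²(0,s)`, conjugate-linear in the first slot, written for functions. -/
def innerL2 (s : ℝ) (u v : ℝ → ℂ) : ℂ := ∫ x in Ioo (0 : ℝ) s, conj (u x) * v x

theorem innerL2_eq_inner (s : ℝ) (φ ψ : L2Space s) : innerL2 s φ ψ = inner ℂ φ ψ := by
  rw [L2.inner_def]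
  simp [innerL2, RCLike.inner_apply, mul_comm]

/-- `IsTauImage V b u v g` says that, on `[0,b]`, the function `u` is continuously differentiable
with `u' = v`, that `v` is absolutely continuous (an indefinite integral of an integrable
function), and that `v' = V u - g` almost everywhere; that is, `τ u = -u'' + V u = g`. -/
structure IsTauImage (V : ℝ → ℝ) (b : ℝ) (u v g : ℝ → ℂ) : Prop where
  hasDeriv : ∀ x ∈ Icc 0 b, HasDerivWithinAt u (v x) (Icc 0 b) x
  integrable : IntegrableOn (fun y => (V y : ℂ) * u y - g y) (Icc 0 b)
  eq_integral : ∀ x ∈ Icc 0 b, v x = v 0 + ∫ y in (0 : ℝ)..x, ((V y : ℂ) * u y - g y)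

/-- `u` solves `-u'' + V u = z u` on `[0,b]`, `u(0) = 1`, `u'(0) = 0`. -/
def IsNeumannSolution (V : ℝ → ℝ) (b : ℝ) (z : ℂ) (u : ℝ → ℂ) : Prop :=
  ∃ v : ℝ → ℂ, IsTauImage V b u v (fun x => z * u x) ∧ u 0 = 1 ∧ v 0 = 0

section Existence

/-- Picard iterates of the integral equation `u = 1 + ∬ q u`. -/
def picardTerm (q : ℝ → ℂ) : ℕ → ℝ → ℂ
  | 0 => fun _ => 1
  | n + 1 => fun x => ∫ s in (0 : ℝ)..x, ∫ y in (0 : ℝ)..s, q y * picardTerm q n y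

theorem picardTerm_continuous {q : ℝ → ℂ} (hq : Continuous q) (n : ℕ) :
    Continuous (picardTerm q n) := by
  induction n with
  | zero => exact continuous_const
  | succ n ih =>
    have h1 : Continuous fun s : ℝ => ∫ y in (0 : ℝ)..s, q y * picardTerm q n y :=
      intervalIntegral.continuous_primitive
        (fun a b => (hq.mul ih).intervalIntegrable a b) 0
    exact intervalIntegral.continuous_primitive (fun a b => h1.intervalIntegrable a b) 0

theorem picardTerm_bound {q : ℝ → ℂ} {M b : ℝ}
    (hb : 0 ≤ b) (hM : ∀ y, ‖q y‖ ≤ M) (n : ℕ) :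
    (∀ x ∈ Icc 0 b, ‖picardTerm q n x‖ ≤ (M * b) ^ n * x ^ n / n.factorial) := by
  have hM0 : 0 ≤ M := (norm_nonneg _).trans (hM 0)
  induction n with
  | zero => intro x hx; simp [picardTerm]
  | succ n ih =>
    intro x hx
    have hin : ∀ s ∈ Icc 0 b,
        ‖∫ y in (0 : ℝ)..s, q y * picardTerm q n y‖ ≤
          (M * b) ^ (n + 1) * s ^ n / n.factorial := by
      intro s hs
      have h1 : ∀ y ∈ Set.uIoc 0 s, ‖q y * picardTerm q n y‖ ≤
          M * ((M * b) ^ n * s ^ n / n.factorial) := by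
        intro y hy
        rw [uIoc_of_le hs.1] at hy
        rw [norm_mul]
        have h2 := ih y ⟨hy.1.le, hy.2.trans hs.2⟩
        have h3 : y ^ n ≤ s ^ n := pow_le_pow_left₀ hy.1.le hy.2 n
        refine mul_le_mul (hM y) (h2.trans ?_) (norm_nonneg _) hM0
        have : 0 ≤ (M * b) ^ n := by positivity
        gcongr
      refine (intervalIntegral.norm_integral_le_of_norm_le_const h1).trans ?_
      rw [sub_zero, abs_of_nonneg hs.1]
      have hsn : 0 ≤ s ^ n := pow_nonneg hs.1 n
      have : M * ((M * b) ^ n * s ^ n / n.factorial) * s ≤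
          M * ((M * b) ^ n * s ^ n / n.factorial) * b := by
        apply mul_le_mul_of_nonneg_left hs.2; positivity
      refine this.trans (le_of_eq ?_)
      ring
    have h4 : ‖picardTerm q (n + 1) x‖ ≤
        ∫ s in (0 : ℝ)..x, (M * b) ^ (n + 1) * s ^ n / n.factorial := by
      refine intervalIntegral.norm_integral_le_of_norm_le hx.1 ?_ ?_
      · exact Eventually.of_forall fun s hs => hin s ⟨hs.1.le, hs.2.trans hx.2⟩
      · exact Continuous.intervalIntegrable (by fun_prop) _ _
    refine h4.trans (le_of_eq ?_)
    rw [intervalIntegral.integral_div, intervalIntegral.integral_const_mul, integral_pow,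
      Nat.factorial_succ]
    push_cast
    field_simp
    ring

/-- Integrating a series of continuous functions that is dominated on `[0,b]`. -/
theorem hasSum_primitive {F : ℕ → ℝ → ℂ} (hF : ∀ n, Continuous (F n)) {c : ℕ → ℝ}
    (hc : Summable c) {b : ℝ} (hFc : ∀ n, ∀ x ∈ Icc 0 b, ‖F n x‖ ≤ c n) {x : ℝ}
    (hx : x ∈ Icc 0 b) :
    HasSum (fun n => ∫ y in (0 : ℝ)..x, F n y) (∫ y in (0 : ℝ)..x, ∑' n, F n y) := by
  have hsub : ∀ y ∈ Set.uIoc 0 x, y ∈ Icc 0 b := fun y hy => by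
    rw [uIoc_of_le hx.1] at hy
    exact ⟨hy.1.le, hy.2.trans hx.2⟩
  refine intervalIntegral.hasSum_integral_of_dominated_convergence (fun n _ => c n)
    (fun n => (hF n).aestronglyMeasurable) ?_ ?_ ?_ ?_
  · exact fun n => Eventually.of_forall fun y hy => hFc n y (hsub y hy)
  · exact Eventually.of_forall fun _ _ => hc
  · exact intervalIntegrable_const
  · exact Eventually.of_forall fun y hy =>
      (Summable.of_norm_bounded hc fun n => hFc n y (hsub y hy)).hasSum

/-- The initial value problem has a solution when `V` is continuous on `[0,b]`. -/
theorem exists_isNeumannSolution {V : ℝ → ℝ} {b : ℝ} (hb : 0 ≤ b)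
    (hV : ContinuousOn V (Icc 0 b)) (z : ℂ) : ∃ u, IsNeumannSolution V b z u := by
  set W : ℝ → ℝ := IccExtend hb (fun y : Icc 0 b => V y) with hW
  have hWc : Continuous W := (continuousOn_iff_continuous_domRestrict.1 hV).Icc_extend'
  have hWV : ∀ y ∈ Icc 0 b, W y = V y := fun y hy => IccExtend_of_mem hb _ hy
  obtain ⟨M₀, hM₀⟩ := isCompact_Icc.exists_bound_of_continuousOn hV
  set q : ℝ → ℂ := fun y => (W y : ℂ) - z with hqdef
  have hq : Continuous q := (Complex.continuous_ofReal.comp hWc).sub continuous_const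
  have hM : ∀ y, ‖q y‖ ≤ M₀ + ‖z‖ := by
    intro y
    refine (norm_sub_le _ _).trans ?_
    rw [Complex.norm_real]
    gcongr
    exact hM₀ _ (projIcc 0 b hb y).2
  set M := M₀ + ‖z‖
  have hM0 : 0 ≤ M := (norm_nonneg _).trans (hM 0)
  set c : ℕ → ℝ := fun n => (M * b * b) ^ n / n.factorial with hcdef
  have hc : Summable c := Real.summable_pow_div_factorial _
  have hterm : ∀ n, ∀ x ∈ Icc 0 b, ‖picardTerm q n x‖ ≤ c n := by
    intro n x hx
    refine (picardTerm_bound hb hM n x hx).trans ?_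
    rw [hcdef]
    simp only [mul_pow (M * b) b]
    have : x ^ n ≤ b ^ n := pow_le_pow_left₀ hx.1 hx.2 n
    have : 0 ≤ (M * b) ^ n := by positivity
    gcongr
  have hqterm : ∀ n, ∀ x ∈ Icc 0 b, ‖q x * picardTerm q n x‖ ≤ M * c n := by
    intro n x hx
    rw [norm_mul]
    exact mul_le_mul (hM x) (hterm n x hx) (norm_nonneg _) hM0
  set G : ℕ → ℝ → ℂ := fun n s => ∫ y in (0 : ℝ)..s, q y * picardTerm q n y with hG
  have hGc : ∀ n, Continuous (G n) := fun n =>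
    intervalIntegral.continuous_primitive
      (fun _ _ => (hq.mul (picardTerm_continuous hq n)).intervalIntegrable _ _) 0
  have hGb : ∀ n, ∀ x ∈ Icc 0 b, ‖G n x‖ ≤ M * c n * b := by
    intro n x hx
    have h1 : ∀ y ∈ Set.uIoc 0 x, ‖q y * picardTerm q n y‖ ≤ M * c n := fun y hy => by
      rw [uIoc_of_le hx.1] at hy
      exact hqterm n y ⟨hy.1.le, hy.2.trans hx.2⟩
    refine (intervalIntegral.norm_integral_le_of_norm_le_const h1).trans ?_
    rw [sub_zero, abs_of_nonneg hx.1]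
    have : 0 ≤ c n := by positivity
    exact mul_le_mul_of_nonneg_left hx.2 (by positivity)
  set u : ℝ → ℂ := fun x => ∑' n, picardTerm q n x with hu
  set v : ℝ → ℂ := fun x => ∑' n, G n x with hv
  have huc : ContinuousOn u (Icc 0 b) :=
    continuousOn_tsum (fun n => (picardTerm_continuous hq n).continuousOn) hc hterm
  have hvc : ContinuousOn v (Icc 0 b) :=
    continuousOn_tsum (fun n => (hGc n).continuousOn) ((hc.mul_left M).mul_right b) hGb
  have hvint : ∀ x ∈ Icc 0 b, v x = ∫ y in (0 : ℝ)..x, ((V y : ℂ) * u y - z * u y) := by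
    intro x hx
    have hsum := (hasSum_primitive (fun n => hq.mul (picardTerm_continuous hq n))
      (hc.mul_left M) hqterm hx).tsum_eq
    refine Eq.trans hsum ?_
    refine intervalIntegral.integral_congr fun y hy => ?_
    rw [uIcc_of_le hx.1] at hy
    have hyb : y ∈ Icc 0 b := ⟨hy.1, hy.2.trans hx.2⟩
    simp only [Pi.mul_apply, tsum_mul_left, hqdef, hWV y hyb, hu]
    ring
  have huint : ∀ x ∈ Icc 0 b, u x = 1 + ∫ s in (0 : ℝ)..x, v s := by
    intro x hx
    have h1 := (hasSum_primitive hGc ((hc.mul_left M).mul_right b) hGb hx).tsum_eq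
    have h2 : Summable fun n => picardTerm q n x :=
      Summable.of_norm_bounded hc fun n => hterm n x hx
    rw [hu, hv]
    simp only
    rw [h2.tsum_eq_zero_add, ← h1]
    rfl
  have h0 : (0 : ℝ) ∈ Icc 0 b := ⟨le_rfl, hb⟩
  have hv0 : v 0 = 0 := by rw [hvint 0 h0]; simp
  have hu0 : u 0 = 1 := by rw [huint 0 h0]; simp
  refine ⟨u, v, ⟨?_, ?_, ?_⟩, hu0, hv0⟩
  · intro x hx
    have hvi : IntervalIntegrable v volume 0 x :=
      (hvc.mono (by rw [uIcc_of_le hx.1]; exact Icc_subset_Icc_right hx.2)).intervalIntegrable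
    have : Fact (x ∈ Icc 0 b) := ⟨hx⟩
    have h1 : HasDerivWithinAt (fun x => ∫ s in (0 : ℝ)..x, v s) (v x) (Icc 0 b) x :=
      intervalIntegral.integral_hasDerivWithinAt_right hvi
        (hvc.stronglyMeasurableAtFilter_nhdsWithin measurableSet_Icc x) (hvc x hx)
    exact (h1.const_add 1).congr huint (huint x hx)
  · have hVC : ContinuousOn (fun y => (V y : ℂ)) (Icc 0 b) :=
      Complex.continuous_ofReal.comp_continuousOn hV
    exact ((hVC.mul huc).sub (continuousOn_const.mul huc)).integrableOn_Icc
  · intro x hx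
    rw [hv0, zero_add, hvint x hx]

end Existence

open Classical in
/-- The solution `ξ(x,z)`, `0 ≤ x ≤ b`, of `-ξ'' + V ξ = z ξ`, `ξ(0,z) = 1`, `ξ'(0,z) = 0`,
for a potential `V` on `[0,b]`. -/
def xi (V : ℝ → ℝ) (b x : ℝ) (z : ℂ) : ℂ :=
  if h : ∃ u, IsNeumannSolution V b z u then h.choose x else 0

theorem xi_isNeumannSolution {V : ℝ → ℝ} {b : ℝ} (hb : 0 ≤ b)
    (hV : ContinuousOn V (Icc 0 b)) (z : ℂ) : IsNeumannSolution V b z (fun x => xi V b x z) := by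
  have h := exists_isNeumannSolution hb hV z
  simp only [xi, dif_pos h]
  exact h.choose_spec

/-- For a potential `V` on `[0,b]` and `s ≤ b`, the set of functions of the de Branges space
`B_s`: all `f(z) = ⟨ξ(·, z̄), φ⟩` with `φ ∈ L²(0,s)`. -/
def deBrangesSpace (V : ℝ → ℝ) (b s : ℝ) : Set (ℂ → ℂ) :=
  {f | ∃ φ : L2Space s, ∀ z, f z = innerL2 s (fun x => xi V b x (conj z)) φ}

/-- The reproducing kernel `k_b(z,w) = ⟨ξ(·, z̄), ξ(·, w̄)⟩` of `B_b`. -/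
def reproducingKernel (V : ℝ → ℝ) (b : ℝ) (z w : ℂ) : ℂ :=
  innerL2 b (fun x => xi V b x (conj z)) (fun x => xi V b x (conj w))

/-- The piecewise linear cutoff: `1` on `[0,a]` and `(b-x)/(b-a)` on `(a,b]`. -/
def cutoff (a b x : ℝ) : ℝ := if x ≤ a then 1 else (b - x) / (b - a)

/-- The modified sampling kernel `⟨ξ(·, z̄), R_{ab} ξ(·, t)⟩ / k_b(t,t)`. -/
def modifiedKernel (V : ℝ → ℝ) (a b : ℝ) (z t : ℂ) : ℂ :=
  1 / reproducingKernel V b t t *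
    innerL2 b (fun x => xi V b x (conj z)) (fun x => (cutoff a b x : ℂ) * xi V b x t)

/-- The pairs `(φ, τ φ)` with `φ, τ φ ∈ L²(0,b)`, `φ'(0) = 0` and
`φ(b) cos γ + φ'(b) sin γ = 0`. -/
def schrodingerGraph (V : ℝ → ℝ) (b γ : ℝ) : Submodule ℂ (L2Space b × L2Space b) where
  carrier := {p | ∃ u v g : ℝ → ℂ,
    p.1 =ᵐ[volume.restrict (Ioo 0 b)] u ∧ p.2 =ᵐ[volume.restrict (Ioo 0 b)] g ∧
    IsTauImage V b u v g ∧ v 0 = 0 ∧ u b * Real.cos γ + v b * Real.sin γ = 0}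
  zero_mem' := by
    refine ⟨0, 0, 0, Lp.coeFn_zero _ _ _, Lp.coeFn_zero _ _ _, ⟨?_, ?_, ?_⟩, by simp, by simp⟩
    · intro x _
      exact hasDerivWithinAt_const x _ 0
    · simp
    · simp
  add_mem' := by
    rintro p p' ⟨u, v, g, h1, h2, h3, h4, h5⟩ ⟨u', v', g', h1', h2', h3', h4', h5'⟩
    refine ⟨u + u', v + v', g + g', ?_, ?_, ⟨?_, ?_, ?_⟩, ?_, ?_⟩
    · exact (Lp.coeFn_add _ _).trans (h1.add h1')
    · exact (Lp.coeFn_add _ _).trans (h2.add h2')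
    · exact fun x hx => (h3.hasDeriv x hx).add (h3'.hasDeriv x hx)
    · refine (h3.integrable.add h3'.integrable).congr (Eventually.of_forall fun y => ?_)
      simp only [Pi.add_apply]
      ring
    · intro x hx
      have hsub : Set.uIoc 0 x ⊆ Icc 0 b := by
        rw [uIoc_of_le hx.1]
        exact fun y hy => ⟨hy.1.le, hy.2.trans hx.2⟩
      have hi := intervalIntegrable_iff.2 (h3.integrable.mono_set hsub)
      have hi' := intervalIntegrable_iff.2 (h3'.integrable.mono_set hsub)
      have hadd := intervalIntegral.integral_add hi hi'
      have : (fun y => (V y : ℂ) * (u + u') y - (g + g') y) =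
          fun y => ((V y : ℂ) * u y - g y) + ((V y : ℂ) * u' y - g' y) := by
        funext y
        simp only [Pi.add_apply]
        ring
      rw [this, hadd, Pi.add_apply, Pi.add_apply, h3.eq_integral x hx, h3'.eq_integral x hx]
      ring
    · simp [h4, h4']
    · simp only [Pi.add_apply]
      linear_combination h5 + h5'
  smul_mem' := by
    rintro c p ⟨u, v, g, h1, h2, h3, h4, h5⟩
    refine ⟨c • u, c • v, c • g, ?_, ?_, ⟨?_, ?_, ?_⟩, ?_, ?_⟩
    · exact (Lp.coeFn_smul _ _).trans (h1.const_smul c)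
    · exact (Lp.coeFn_smul _ _).trans (h2.const_smul c)
    · exact fun x hx => (h3.hasDeriv x hx).const_smul c
    · refine (h3.integrable.const_mul c).congr (Eventually.of_forall fun y => ?_)
      simp only [Pi.smul_apply, smul_eq_mul]
      ring
    · intro x hx
      have : (fun y => (V y : ℂ) * (c • u) y - (c • g) y) =
          fun y => c * ((V y : ℂ) * u y - g y) := by
        funext y
        simp only [Pi.smul_apply, smul_eq_mul]
        ring
      rw [this, intervalIntegral.integral_const_mul, Pi.smul_apply, Pi.smul_apply,
        h3.eq_integral x hx, smul_eq_mul, smul_eq_mul]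
      ring
    · simp [h4]
    · simp only [Pi.smul_apply, smul_eq_mul]
      linear_combination c * h5

/-- The selfadjoint operator `H_b(γ)` in `L²(0,b)`: `φ ↦ τ φ` with the boundary conditions
`φ'(0) = 0` and `φ(b) cos γ + φ'(b) sin γ = 0`. -/
def schrodingerOperator (V : ℝ → ℝ) (b γ : ℝ) : L2Space b →ₗ.[ℂ] L2Space b :=
  (schrodingerGraph V b γ).toLinearPMap

/-- The graph of the operator `H_b(γ)` is the set of pairs above: `τ φ` is determined by `φ`. -/
theorem schrodingerOperator_graph (V : ℝ → ℝ) {b : ℝ} (hb : 0 < b) (γ : ℝ) :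
    (schrodingerOperator V b γ).graph = schrodingerGraph V b γ := by
  refine Submodule.toLinearPMap_graph_eq _ ?_
  rintro ⟨φ, ψ⟩ ⟨u, v, g, h1, h2, h3, -, -⟩ h0
  simp only at h0 h1 h2 ⊢
  subst h0
  have hu0 : u =ᵐ[volume.restrict (Ioo 0 b)] (fun _ => (0 : ℂ)) :=
    h1.symm.trans (Lp.coeFn_zero _ _ _)
  have huc : ContinuousOn u (Icc 0 b) := fun x hx => (h3.hasDeriv x hx).continuousWithinAt
  have hu : EqOn u (fun _ => 0) (Ioo 0 b) :=
    Measure.eqOn_open_of_ae_eq hu0 isOpen_Ioo (huc.mono Ioo_subset_Icc_self) continuousOn_const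
  have huI : EqOn u (fun _ => 0) (Icc 0 b) := by
    have := hu.of_subset_closure huc continuousOn_const Ioo_subset_Icc_self
      (by rw [closure_Ioo hb.ne])
    exact this
  have hv : ∀ x ∈ Icc 0 b, v x = 0 := by
    intro x hx
    have h4 := (hasDerivWithinAt_const x (Icc 0 b) (0 : ℂ)).congr huI (huI hx)
    exact (uniqueDiffOn_Icc hb x hx).eq_deriv _ (h3.hasDeriv x hx) h4
  set w : ℝ → ℂ := fun y => (V y : ℂ) * u y - g y with hw
  have hint : ∀ x ∈ Icc 0 b, ∫ y in (0 : ℝ)..x, w y = 0 := by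
    intro x hx
    have h5 := h3.eq_integral x hx
    rw [hv x hx, hv 0 ⟨le_rfl, hb.le⟩, zero_add] at h5
    exact h5.symm
  have hwi : IntervalIntegrable w volume 0 b :=
    intervalIntegrable_iff.2 (h3.integrable.mono_set (by
      rw [uIoc_of_le hb.le]; exact Ioc_subset_Icc_self))
  have hw0 : ∀ᵐ x ∂(volume.restrict (Ioo 0 b)), w x = 0 := by
    rw [ae_restrict_iff' measurableSet_Ioo]
    filter_upwards [hwi.ae_hasDerivAt_integral] with x hx hxI
    have hxI' : x ∈ Set.uIcc 0 b := by
      rw [uIcc_of_le hb.le]; exact Ioo_subset_Icc_self hxI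
    have h6 := hx hxI' 0 (by rw [uIcc_of_le hb.le]; exact ⟨le_rfl, hb.le⟩)
    have h7 : (fun y => ∫ t in (0 : ℝ)..y, w t) =ᶠ[𝓝 x] fun _ => 0 := by
      filter_upwards [isOpen_Ioo.mem_nhds hxI] with y hy
      exact hint y (Ioo_subset_Icc_self hy)
    exact h6.unique ((hasDerivAt_const x (0 : ℂ)).congr_of_eventuallyEq h7)
  refine Lp.ext (h2.trans (?_ : g =ᵐ[_] _))
  filter_upwards [hw0, hu0, Lp.coeFn_zero ℂ 2 (volume.restrict (Ioo 0 b))] with x hx1 hx2 hx3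
  rw [hx3]
  simp only [hw, hx2, mul_zero, zero_sub, neg_eq_zero] at hx1
  simpa using hx1

/-- The spectrum of an unbounded operator `T`: the complement of the set of `z` for which
`T - z` is a bijection of the domain of `T` onto the space with a bounded inverse `R`. -/
def unboundedSpectrum {E : Type*} [NormedAddCommGroup E] [NormedSpace ℂ E] (T : E →ₗ.[ℂ] E) :
    Set ℂ :=
  {z | ¬ ∃ R : E →L[ℂ] E,
    (∀ h : E, ∃ hd : R h ∈ T.domain, T ⟨R h, hd⟩ - z • R h = h) ∧
    ∀ φ : T.domain, R (T φ - z • (φ : E)) = φ}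

/-- The spectrum of `H_b(γ)`. -/
def samplingPoints (V : ℝ → ℝ) (b γ : ℝ) : Set ℂ :=
  unboundedSpectrum (schrodingerOperator V b γ)

/-- The perturbed series `∑_t K̃_{ab}(z,t) (f(t) + ε_t)`, `t` in the spectrum of `H_b(γ)`. -/
def perturbedSeries (V : ℝ → ℝ) (a b γ : ℝ) (f : ℂ → ℂ) (ε : samplingPoints V b γ → ℂ)
    (z : ℂ) : ℂ :=
  ∑' t : samplingPoints V b γ, modifiedKernel V a b z t * (f t + ε t)

end

/-! Write `b = π` and let `N t` be the norm of `ξ(·,t)` in `L²(0,b)`. The Neumann eigenfunctions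
`e_t = ξ(·,t)/N t` form an orthonormal basis. If `f` is represented by `φ` on `(0,a)`, extend `φ` by
zero to `Φ`. Then `f t = ⟪ξ(·,t), Φ⟫`, and since the cutoff `R` is `1` on the support of `Φ`, `f z =
⟪R ξ(·,z̄), Φ⟫`. Parseval's identity for this inner product is exactly the unperturbed sampling
formula (`exists_bound_and_hasSum`). The error is therefore minus the series of `modifiedKernel V a
b z t * ε t`, and everything reduces to bounding the kernel by summable weights, uniformly for `z`
in a bounded set.

The weights need no eigenvalue asymptotics. Choose a real `μ` with `μ + 1 ≤ V`. Two integrations by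
parts, on `[0,a]` and on `[a,b]`, gain a factor `1/(t - μ)` (`exists_innerL2_cutoff_bound`). Because
`R` is continuous and vanishes at `b`, the terms with `ξ'(a,t)` cancel, and the boundary contributes
only multiples of `ξ(a,t)` and `ξ(b,t)`. After division by `N t ^ 2`, the products that remain are
dominated by `|e_t(x)|²/(t - μ)` for `x = 0, a, b` and by `1/(t - μ)`; the point `0` enters since
`|e_t(0)| = 1/N t`.

The sum of `|e_t(x)|²/(t - μ)` is the diagonal of the Green function at `μ`. It is bounded by a
Sobolev constant, because the energy form dominates the Sobolev norm (`sum_norm_eigenFun_sq_le`);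
integrating over `x` gives the summability of `1/(t - μ)` (`summable_inv_re_sub`).

Completeness of the `e_t` comes from the spectral theorem for the resolvent at `μ`, a compact
symmetric integral operator with continuous kernel. -/

/-! ### Absolutely continuous functions given by densities -/

/-- `A` is absolutely continuous on `[0,b]` with density `a`. -/
structure HasDensityOn (b : ℝ) (A a : ℝ → ℂ) : Prop where
  integrable : IntegrableOn a (Icc 0 b)
  eq_integral : ∀ x ∈ Icc 0 b, A x = A 0 + ∫ y in (0 : ℝ)..x, a y

theorem intervalIntegrable_of_integrableOn_Icc {E : Type*} [NormedAddCommGroup E] {b x y : ℝ}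
    {a : ℝ → E} (ha : IntegrableOn a (Icc 0 b)) (hx : x ∈ Icc 0 b) (hy : y ∈ Icc 0 b) :
    IntervalIntegrable a volume x y :=
  intervalIntegrable_iff.2 (ha.mono_set (uIoc_subset_uIcc.trans (uIcc_subset_Icc hx hy)))

theorem continuousOn_primitive_of_integrableOn {E : Type*} [NormedAddCommGroup E] [NormedSpace ℝ E]
    {b : ℝ} {a : ℝ → E} (ha : IntegrableOn a (Icc 0 b)) :
    ContinuousOn (fun x => ∫ y in (0 : ℝ)..x, a y) (Icc 0 b) := by
  refine (intervalIntegral.continuousOn_primitive_Icc ha).congr fun x hx => ?_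
  simp only
  rw [intervalIntegral.integral_of_le hx.1, integral_Icc_eq_integral_Ioc]

namespace HasDensityOn

variable {b : ℝ} {A B a c : ℝ → ℂ}

theorem intervalIntegrable (h : HasDensityOn b A a) {x y : ℝ} (hx : x ∈ Icc 0 b)
    (hy : y ∈ Icc 0 b) : IntervalIntegrable a volume x y :=
  intervalIntegrable_of_integrableOn_Icc h.integrable hx hy

theorem sub_eq (h : HasDensityOn b A a) {x y : ℝ} (hx : x ∈ Icc 0 b) (hy : y ∈ Icc 0 b) :
    A y - A x = ∫ s in x..y, a s := by
  have h0 : (0 : ℝ) ∈ Icc 0 b := ⟨le_rfl, hx.1.trans hx.2⟩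
  rw [h.eq_integral x hx, h.eq_integral y hy, ← intervalIntegral.integral_interval_sub_left
    (h.intervalIntegrable h0 hy) (h.intervalIntegrable h0 hx)]
  ring

theorem continuousOn (h : HasDensityOn b A a) : ContinuousOn A (Icc 0 b) :=
  (continuousOn_const.add (continuousOn_primitive_of_integrableOn h.integrable)).congr
    h.eq_integral

theorem add (hA : HasDensityOn b A a) (hB : HasDensityOn b B c) :
    HasDensityOn b (fun x => A x + B x) (fun x => a x + c x) := by
  refine ⟨hA.integrable.add hB.integrable, fun x hx => ?_⟩
  have h0 : (0 : ℝ) ∈ Icc 0 b := ⟨le_rfl, hx.1.trans hx.2⟩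
  rw [intervalIntegral.integral_add (hA.intervalIntegrable h0 hx) (hB.intervalIntegrable h0 hx),
    hA.eq_integral x hx, hB.eq_integral x hx]
  ring

theorem const_mul (k : ℂ) (hA : HasDensityOn b A a) :
    HasDensityOn b (fun x => k * A x) (fun x => k * a x) := by
  refine ⟨hA.integrable.const_mul k, fun x hx => ?_⟩
  rw [intervalIntegral.integral_const_mul, hA.eq_integral x hx]
  ring

theorem congr (hA : HasDensityOn b A a) (hB : EqOn B A (Icc 0 b)) (hc : EqOn c a (Icc 0 b)) :
    HasDensityOn b B c := by
  refine ⟨hA.integrable.congr_fun hc.symm measurableSet_Icc, fun x hx => ?_⟩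
  have h0 : (0 : ℝ) ∈ Icc 0 b := ⟨le_rfl, hx.1.trans hx.2⟩
  rw [hB hx, hB h0, hA.eq_integral x hx]
  congr 1
  refine intervalIntegral.integral_congr fun y hy => (hc ?_).symm
  exact uIcc_subset_Icc h0 hx hy

theorem star (hA : HasDensityOn b A a) :
    HasDensityOn b (fun x => conj (A x)) (fun x => conj (a x)) := by
  refine ⟨?_, fun x hx => ?_⟩
  · exact (Complex.conjCLE : ℂ →L[ℝ] ℂ).integrable_comp hA.integrable
  · have h0 : (0 : ℝ) ∈ Icc 0 b := ⟨le_rfl, hx.1.trans hx.2⟩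
    have := (Complex.conjCLE : ℂ →L[ℝ] ℂ).intervalIntegral_comp_comm
      (hA.intervalIntegrable h0 hx)
    rw [hA.eq_integral x hx, map_add]
    congr 1
    exact this.symm

theorem hasDerivWithinAt (hA : HasDensityOn b A a) (ha : ContinuousOn a (Icc 0 b)) {x : ℝ}
    (hx : x ∈ Icc 0 b) : HasDerivWithinAt A (a x) (Icc 0 b) x := by
  have h0 : (0 : ℝ) ∈ Icc 0 b := ⟨le_rfl, hx.1.trans hx.2⟩
  have : Fact (x ∈ Icc 0 b) := ⟨hx⟩
  have h1 : HasDerivWithinAt (fun x => ∫ s in (0 : ℝ)..x, a s) (a x) (Icc 0 b) x :=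
    intervalIntegral.integral_hasDerivWithinAt_right (hA.intervalIntegrable h0 hx)
      (ha.stronglyMeasurableAtFilter_nhdsWithin measurableSet_Icc x) (ha x hx)
  exact (h1.const_add (A 0)).congr hA.eq_integral (hA.eq_integral x hx)

end HasDensityOn

theorem HasDerivWithinAt.of_Icc_Ici {E : Type*} [NormedAddCommGroup E] [NormedSpace ℝ E]
    {f : ℝ → E} {f' : E} {b x : ℝ} (h : HasDerivWithinAt f f' (Icc 0 b) x) (hx : x ∈ Ico 0 b) :
    HasDerivWithinAt f f' (Ici x) x :=
  h.mono_of_mem_nhdsWithin (mem_of_superset (Icc_mem_nhdsGE hx.2) (Icc_subset_Icc_left hx.1))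

theorem hasDensityOn_of_hasDerivWithinAt {b : ℝ} {F F' : ℝ → ℂ}
    (hF : ∀ x ∈ Icc 0 b, HasDerivWithinAt F (F' x) (Icc 0 b) x)
    (hF' : ContinuousOn F' (Icc 0 b)) : HasDensityOn b F F' := by
  refine ⟨hF'.integrableOn_Icc, fun x hx => ?_⟩
  have h0 : (0 : ℝ) ∈ Icc 0 b := ⟨le_rfl, hx.1.trans hx.2⟩
  rw [intervalIntegral.integral_eq_sub_of_hasDeriv_right_of_le hx.1 (f := F) (f' := F')]
  · ring
  · exact fun y hy => ((hF y ⟨hy.1, hy.2.trans hx.2⟩).continuousWithinAt).mono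
      (Icc_subset_Icc_right hx.2)
  · intro y hy
    exact ((hF y ⟨hy.1.le, hy.2.le.trans hx.2⟩).of_Icc_Ici ⟨hy.1.le, hy.2.trans_le hx.2⟩).mono
      Ioi_subset_Ici_self
  · exact intervalIntegrable_of_integrableOn_Icc hF'.integrableOn_Icc h0 hx

/-- The product of a continuously differentiable and an absolutely continuous function. -/
theorem HasDensityOn.deriv_mul {b : ℝ} {F F' A a : ℝ → ℂ}
    (hF : ∀ x ∈ Icc 0 b, HasDerivWithinAt F (F' x) (Icc 0 b) x)
    (hF' : ContinuousOn F' (Icc 0 b)) (hA : HasDensityOn b A a) :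
    HasDensityOn b (fun x => F x * A x) (fun x => F' x * A x + F x * a x) := by
  have hFd := hasDensityOn_of_hasDerivWithinAt hF hF'
  have hFc := hFd.continuousOn
  have hi : IntegrableOn (fun x => F' x * A x + F x * a x) (Icc 0 b) :=
    (hF'.mul hA.continuousOn).integrableOn_Icc.add
      (hA.integrable.continuousOn_mul hFc isCompact_Icc)
  refine ⟨hi, ?_⟩
  obtain ⟨M, hM⟩ := isCompact_Icc.exists_bound_of_continuousOn hF'
  -- The product rule amounts to `D` being constant. No almost everywhere differentiation is used:
  -- the increments of `D` over `[x,y]` are `(y - x)` times a quantity tending to `0`, so `D` has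
  -- right derivative zero everywhere.
  set D : ℝ → ℂ := fun x => F x * A x - ∫ y in (0 : ℝ)..x, (F' y * A y + F y * a y) with hD
  have hgi : IntegrableOn (fun y => ‖a y‖) (Icc 0 b) := hA.integrable.norm
  have key : ∀ x ∈ Icc 0 b, ∀ y ∈ Icc 0 b, x ≤ y →
      ‖D y - D x‖ ≤ (y - x) * (2 * M * ∫ s in x..y, ‖a s‖) := by
    intro x hx y hy hxy
    have h0 : (0 : ℝ) ∈ Icc 0 b := ⟨le_rfl, hx.1.trans hx.2⟩
    have hM0 : 0 ≤ M := (norm_nonneg _).trans (hM 0 h0)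
    have hsub : ∀ s ∈ Icc x y, s ∈ Icc 0 b := fun s hs => ⟨hx.1.trans hs.1, hs.2.trans hy.2⟩
    have e1 : D y - D x = ∫ s in x..y, ((F x - F s) * a s + F' s * (A y - A s)) := by
      -- The increment of the product is `F x (A y - A x) + (F y - F x) A y`. With the factors
      -- frozen at the end points, only differences of `F` and of `A` survive in the integrand of
      -- `e1`.
      have e2 : F y * A y - F x * A x = ∫ s in x..y, (F x * a s + F' s * A y) := by
        rw [intervalIntegral.integral_add ((hA.intervalIntegrable hx hy).const_mul _)
          ((hFd.intervalIntegrable hx hy).mul_const _), intervalIntegral.integral_const_mul,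
          intervalIntegral.integral_mul_const, ← hA.sub_eq hx hy, ← hFd.sub_eq hx hy]
        ring
      have e3 : D y - D x = (F y * A y - F x * A x) -
          ∫ s in x..y, (F' s * A s + F s * a s) := by
        rw [← intervalIntegral.integral_interval_sub_left
          (intervalIntegrable_of_integrableOn_Icc hi h0 hy)
          (intervalIntegrable_of_integrableOn_Icc hi h0 hx)]
        simp only [hD]
        ring
      rw [e3, e2, ← intervalIntegral.integral_sub]
      · congr 1
        funext s
        ring
      · exact ((hA.intervalIntegrable hx hy).const_mul _).add
          ((hFd.intervalIntegrable hx hy).mul_const _)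
      · exact intervalIntegrable_of_integrableOn_Icc hi hx hy
    rw [e1]
    set G := ∫ s in x..y, ‖a s‖
    have hFb : ∀ s ∈ Icc x y, ‖F x - F s‖ ≤ M * (y - x) := by
      intro s hs
      rw [norm_sub_rev, hFd.sub_eq hx (hsub s hs)]
      refine (intervalIntegral.norm_integral_le_of_norm_le_const (C := M) fun r hr => ?_).trans ?_
      · rw [uIoc_of_le hs.1] at hr
        exact hM r (hsub r ⟨hr.1.le, hr.2.trans hs.2⟩)
      · rw [abs_of_nonneg (sub_nonneg.2 hs.1)]
        exact mul_le_mul_of_nonneg_left (by linarith [hs.2]) hM0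
    have hAb : ∀ s ∈ Icc x y, ‖A y - A s‖ ≤ G := by
      intro s hs
      rw [hA.sub_eq (hsub s hs) hy]
      refine (intervalIntegral.norm_integral_le_integral_norm hs.2).trans ?_
      exact intervalIntegral.integral_mono_interval hs.1 hs.2 le_rfl
        (Eventually.of_forall fun _ => norm_nonneg _)
        (intervalIntegrable_of_integrableOn_Icc hgi hx hy)
    have hle : ‖∫ s in x..y, ((F x - F s) * a s + F' s * (A y - A s))‖ ≤
        ∫ s in x..y, (M * (y - x) * ‖a s‖ + M * G) := by
      refine intervalIntegral.norm_integral_le_of_norm_le hxy ?_ ?_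
      · refine Eventually.of_forall fun s hs => ?_
        have hs' : s ∈ Icc x y := ⟨hs.1.le, hs.2⟩
        refine (norm_add_le _ _).trans ?_
        rw [norm_mul, norm_mul]
        have := hFb s hs'
        have := hAb s hs'
        have := hM s (hsub s hs')
        gcongr
      · exact ((intervalIntegrable_of_integrableOn_Icc hgi hx hy).const_mul _).add
          intervalIntegrable_const
    refine hle.trans (le_of_eq ?_)
    rw [intervalIntegral.integral_add
      ((intervalIntegrable_of_integrableOn_Icc hgi hx hy).const_mul _) intervalIntegrable_const,
      intervalIntegral.integral_const_mul, intervalIntegral.integral_const, smul_eq_mul]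
    ring
  have hDc : ContinuousOn D (Icc 0 b) := by
    exact (hFc.mul hA.continuousOn).sub (continuousOn_primitive_of_integrableOn hi)
  have hDd : ∀ x ∈ Ico 0 b, HasDerivWithinAt D 0 (Ici x) x := by
    intro x hx
    have hx' : x ∈ Icc 0 b := ⟨hx.1, hx.2.le⟩
    have h0 : (0 : ℝ) ∈ Icc 0 b := ⟨le_rfl, hx'.1.trans hx'.2⟩
    have hg : Tendsto (fun y => 2 * M * ∫ s in x..y, ‖a s‖) (𝓝[Icc x b] x) (𝓝 0) := by
      have h1 : ContinuousOn (fun y => ∫ s in (0:ℝ)..y, ‖a s‖) (Icc 0 b) :=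
        continuousOn_primitive_of_integrableOn hgi
      have h2 := ((h1 x hx').mono (Icc_subset_Icc_left hx.1)).tendsto.sub_const
        (∫ s in (0:ℝ)..x, ‖a s‖) |>.const_mul (2 * M)
      rw [sub_self, mul_zero] at h2
      refine h2.congr' ?_
      filter_upwards [self_mem_nhdsWithin] with y hy
      rw [intervalIntegral.integral_interval_sub_left
        (intervalIntegrable_of_integrableOn_Icc hgi h0 ⟨hx.1.trans hy.1, hy.2⟩)
        (intervalIntegrable_of_integrableOn_Icc hgi h0 hx')]
    have h3 : HasDerivWithinAt D 0 (Icc x b) x := by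
      rw [hasDerivWithinAt_iff_isLittleO, Asymptotics.isLittleO_iff]
      intro ε hε
      filter_upwards [self_mem_nhdsWithin, hg.eventually (gt_mem_nhds hε)] with y hy hy2
      have := key x hx' y ⟨hx.1.trans hy.1, hy.2⟩ hy.1
      rw [smul_zero, sub_zero, Real.norm_of_nonneg (sub_nonneg.2 hy.1), mul_comm ε]
      exact this.trans (mul_le_mul_of_nonneg_left hy2.le (sub_nonneg.2 hy.1))
    exact h3.mono_of_mem_nhdsWithin (Icc_mem_nhdsGE hx.2)
  intro x hx
  have := constant_of_has_deriv_right_zero hDc hDd x hx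
  simp only [hD, intervalIntegral.integral_same, sub_zero] at this
  linear_combination this

theorem HasDensityOn.integral_eq {b : ℝ} (hb : 0 ≤ b) {A a : ℝ → ℂ} (h : HasDensityOn b A a) :
    ∫ y in (0 : ℝ)..b, a y = A b - A 0 := by
  rw [h.eq_integral b ⟨hb, le_rfl⟩]
  ring

/-! ### Solutions of the differential equation and Green's identity -/

noncomputable section

variable {V : ℝ → ℝ} {b : ℝ} {z : ℂ} {u v g : ℝ → ℂ}

theorem IsTauImage.hasDensityOn (h : IsTauImage V b u v g) :
    HasDensityOn b v (fun y => (V y : ℂ) * u y - g y) :=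
  ⟨h.integrable, h.eq_integral⟩

theorem IsTauImage.continuousOn (h : IsTauImage V b u v g) : ContinuousOn u (Icc 0 b) :=
  fun x hx => (h.hasDeriv x hx).continuousWithinAt

/-- `u' = v` and `v' = (V - z) u` on `[0,b]`. -/
structure IsClassicalSolution (V : ℝ → ℝ) (b : ℝ) (z : ℂ) (u v : ℝ → ℂ) : Prop where
  deriv_left : ∀ x ∈ Icc 0 b, HasDerivWithinAt u (v x) (Icc 0 b) x
  deriv_right : ∀ x ∈ Icc 0 b, HasDerivWithinAt v (((V x : ℂ) - z) * u x) (Icc 0 b) x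

namespace IsClassicalSolution

theorem continuousOn_left (h : IsClassicalSolution V b z u v) : ContinuousOn u (Icc 0 b) :=
  fun x hx => (h.deriv_left x hx).continuousWithinAt

theorem continuousOn_right (h : IsClassicalSolution V b z u v) : ContinuousOn v (Icc 0 b) :=
  fun x hx => (h.deriv_right x hx).continuousWithinAt

theorem continuousOn_deriv (hV : ContinuousOn V (Icc 0 b)) (h : IsClassicalSolution V b z u v) :
    ContinuousOn (fun x => ((V x : ℂ) - z) * u x) (Icc 0 b) :=
  ((Complex.continuous_ofReal.comp_continuousOn hV).sub continuousOn_const).mul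
    h.continuousOn_left

theorem hasDensityOn_left (h : IsClassicalSolution V b z u v) : HasDensityOn b u v :=
  hasDensityOn_of_hasDerivWithinAt h.deriv_left h.continuousOn_right

theorem hasDensityOn_right (hV : ContinuousOn V (Icc 0 b)) (h : IsClassicalSolution V b z u v) :
    HasDensityOn b v (fun x => ((V x : ℂ) - z) * u x) :=
  hasDensityOn_of_hasDerivWithinAt h.deriv_right (h.continuousOn_deriv hV)

theorem isTauImage (hV : ContinuousOn V (Icc 0 b)) (h : IsClassicalSolution V b z u v) :
    IsTauImage V b u v (fun x => z * u x) := by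
  have := (h.hasDensityOn_right hV).congr (fun _ _ => rfl)
    (c := fun y => (V y : ℂ) * u y - z * u y) (fun x _ => by ring)
  exact ⟨h.deriv_left, this.integrable, this.eq_integral⟩

theorem add {u' v' : ℝ → ℂ} (h : IsClassicalSolution V b z u v)
    (h' : IsClassicalSolution V b z u' v') :
    IsClassicalSolution V b z (fun x => u x + u' x) (fun x => v x + v' x) := by
  refine ⟨fun x hx => (h.deriv_left x hx).add (h'.deriv_left x hx), fun x hx => ?_⟩
  rw [mul_add]
  exact (h.deriv_right x hx).add (h'.deriv_right x hx)

theorem const_mul (k : ℂ) (h : IsClassicalSolution V b z u v) :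
    IsClassicalSolution V b z (fun x => k * u x) (fun x => k * v x) := by
  refine ⟨fun x hx => (h.deriv_left x hx).const_mul k, fun x hx => ?_⟩
  rw [mul_left_comm]
  exact (h.deriv_right x hx).const_mul k

/-- Gronwall's estimate. -/
theorem norm_le {M : ℝ} (hM : ∀ x ∈ Icc 0 b, ‖V x‖ ≤ M) (h : IsClassicalSolution V b z u v) :
    ∀ x ∈ Icc 0 b, ‖(u x, v x)‖ ≤ ‖(u 0, v 0)‖ * Real.exp ((1 + M + ‖z‖) * x) := by
  intro x hx
  have h0 : (0 : ℝ) ∈ Icc 0 b := ⟨le_rfl, hx.1.trans hx.2⟩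
  have hM0 : 0 ≤ M := (norm_nonneg _).trans (hM 0 h0)
  have hc : ContinuousOn (fun x => (u x, v x)) (Icc 0 b) :=
    h.continuousOn_left.prodMk h.continuousOn_right
  -- In the maximum norm, `(v, (V - z) u)` has components bounded by `1` and by `M + ‖z‖` times the
  -- norm of `(u, v)`; the rate is the sum of these two numbers.
  have := norm_le_gronwallBound_of_norm_deriv_right_le (f := fun x => (u x, v x))
    (f' := fun x => (v x, ((V x : ℂ) - z) * u x)) (K := 1 + M + ‖z‖) (ε := 0) hc
    (fun x hx => ((h.deriv_left x ⟨hx.1, hx.2.le⟩).prodMk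
      (h.deriv_right x ⟨hx.1, hx.2.le⟩)).of_Icc_Ici hx) le_rfl ?_ x hx
  · rwa [gronwallBound_ε0, sub_zero] at this
  · intro y hy
    rw [add_zero]
    have hu : ‖u y‖ ≤ ‖(u y, v y)‖ := norm_fst_le (u y, v y)
    have hv : ‖v y‖ ≤ ‖(u y, v y)‖ := norm_snd_le (u y, v y)
    have hVz : ‖(V y : ℂ) - z‖ ≤ M + ‖z‖ := by
      refine (norm_sub_le _ _).trans ?_
      rw [Complex.norm_real]
      gcongr
      exact hM y ⟨hy.1, hy.2.le⟩
    rw [Prod.norm_mk]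
    refine max_le ?_ ?_
    · nlinarith [norm_nonneg z, norm_nonneg (u y, v y)]
    · rw [norm_mul]
      have := mul_le_mul hVz hu (norm_nonneg _) (by positivity)
      nlinarith [norm_nonneg (u y, v y)]

theorem eq_zero (hV : ContinuousOn V (Icc 0 b)) (h : IsClassicalSolution V b z u v)
    (hu : u 0 = 0) (hv : v 0 = 0) : ∀ x ∈ Icc 0 b, u x = 0 ∧ v x = 0 := by
  intro x hx
  obtain ⟨M, hM⟩ := isCompact_Icc.exists_bound_of_continuousOn hV
  have := h.norm_le hM x hx
  rw [hu, hv, Prod.mk_zero_zero, norm_zero, zero_mul, norm_le_zero_iff] at this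
  exact Prod.mk_eq_zero.1 this

end IsClassicalSolution

theorem IsTauImage.isClassicalSolution (hV : ContinuousOn V (Icc 0 b))
    (h : IsTauImage V b u v (fun x => z * u x)) : IsClassicalSolution V b z u v := by
  refine ⟨h.hasDeriv, fun x hx => ?_⟩
  have hc : ContinuousOn (fun y => (V y : ℂ) * u y - z * u y) (Icc 0 b) :=
    ((Complex.continuous_ofReal.comp_continuousOn hV).mul h.continuousOn).sub
      (continuousOn_const.mul h.continuousOn)
  have := h.hasDensityOn.hasDerivWithinAt hc hx
  rwa [← sub_mul] at this

/-- The derivative of `xi` in its space variable. -/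
def xiDeriv (V : ℝ → ℝ) (b x : ℝ) (z : ℂ) : ℂ :=
  derivWithin (fun y => xi V b y z) (Icc 0 b) x

section xi

variable (hb : 0 < b) (hV : ContinuousOn V (Icc 0 b))
include hb hV

theorem xi_spec (z : ℂ) :
    IsClassicalSolution V b z (fun x => xi V b x z) (fun x => xiDeriv V b x z) ∧
      xi V b 0 z = 1 ∧ xiDeriv V b 0 z = 0 := by
  obtain ⟨v, hv, h1, h2⟩ := xi_isNeumannSolution hb.le hV z
  have hs := hv.isClassicalSolution hV
  have he : ∀ x ∈ Icc 0 b, xiDeriv V b x z = v x := fun x hx =>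
    (hs.deriv_left x hx).derivWithin (uniqueDiffOn_Icc hb x hx)
  refine ⟨⟨fun x hx => ?_, fun x hx => ?_⟩, h1, ?_⟩
  · simp only [he x hx]
    exact hs.deriv_left x hx
  · exact (hs.deriv_right x hx).congr he (he x hx)
  · rw [he 0 ⟨le_rfl, hb.le⟩, h2]

/-- The difference `u - u(0) ξ` has zero Cauchy data at `0`, so it vanishes by uniqueness. -/
theorem IsClassicalSolution.eq_xi (h : IsClassicalSolution V b z u v) (hv : v 0 = 0) :
    ∀ x ∈ Icc 0 b, u x = u 0 * xi V b x z ∧ v x = u 0 * xiDeriv V b x z := by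
  intro x hx
  obtain ⟨h1, h2, h3⟩ := xi_spec hb hV z
  have := (h.add (h1.const_mul (-u 0))).eq_zero hV (by simp [h2]) (by simp [h3, hv]) x hx
  exact ⟨by linear_combination this.1, by linear_combination this.2⟩

/-- The solution with Neumann data at the right end point. -/
theorem exists_right_solution (z : ℂ) :
    ∃ u v : ℝ → ℂ, IsClassicalSolution V b z u v ∧ u b = 1 ∧ v b = 0 := by
  -- Reflection of the interval: `ξ` for the potential `V(b - ·)`, read backwards, has its Neumann
  -- data at `b`. The derivative changes sign.
  have hm : MapsTo (fun x => b - x) (Icc 0 b) (Icc 0 b) := fun x hx =>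
    ⟨by linarith [hx.2], by linarith [hx.1]⟩
  have hV' : ContinuousOn (fun x => V (b - x)) (Icc 0 b) :=
    hV.comp (by fun_prop) hm
  obtain ⟨h1, h2, h3⟩ := xi_spec hb hV' z
  have hd : ∀ x ∈ Icc 0 b, HasDerivWithinAt (fun x : ℝ => b - x) (-1) (Icc 0 b) x := fun x _ =>
    ((hasDerivAt_id x).const_sub b).hasDerivWithinAt
  refine ⟨fun x => xi (fun x => V (b - x)) b (b - x) z,
    fun x => -xiDeriv (fun x => V (b - x)) b (b - x) z, ⟨fun x hx => ?_, fun x hx => ?_⟩, ?_, ?_⟩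
  · exact ((h1.deriv_left _ (hm hx)).scomp x (hd x hx) hm).congr_deriv (by simp)
  · exact ((h1.deriv_right _ (hm hx)).scomp x (hd x hx) hm).neg.congr_deriv (by simp)
  · simpa using h2
  · simpa using h3

/-- A uniform bound for the solutions with spectral parameter in a bounded set. -/
theorem exists_xi_bound (ρ : ℝ) : ∃ C, 0 < C ∧ ∀ z : ℂ, ‖z‖ ≤ ρ → ∀ x ∈ Icc 0 b,
    ‖xi V b x z‖ ≤ C ∧ ‖xiDeriv V b x z‖ ≤ C := by
  obtain ⟨M, hM⟩ := isCompact_Icc.exists_bound_of_continuousOn hV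
  refine ⟨Real.exp ((1 + M + ρ) * b), Real.exp_pos _, fun z hz x hx => ?_⟩
  obtain ⟨h1, h2, h3⟩ := xi_spec hb hV z
  have hM0 : 0 ≤ M := (norm_nonneg _).trans (hM x hx)
  have h4 := h1.norm_le hM x hx
  simp only [h2, h3] at h4
  have h5 : ‖((1 : ℂ), (0 : ℂ))‖ = 1 := by simp
  rw [h5, one_mul] at h4
  have h6 : Real.exp ((1 + M + ‖z‖) * x) ≤ Real.exp ((1 + M + ρ) * b) := by
    refine Real.exp_le_exp.2 (mul_le_mul (by linarith) hx.2 hx.1 ?_)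
    linarith [norm_nonneg z]
  exact ⟨(norm_fst_le _).trans (h4.trans h6), (norm_snd_le _).trans (h4.trans h6)⟩

end xi

/-- The symmetry of `τ` under Neumann conditions. -/
theorem IsTauImage.integral_conj_mul (hb : 0 ≤ b) (hV : ContinuousOn V (Icc 0 b))
    {u' v' g' : ℝ → ℂ}
    (h : IsTauImage V b u v g) (h' : IsTauImage V b u' v' g') (h0 : v 0 = 0) (h1 : v b = 0)
    (h0' : v' 0 = 0) (h1' : v' b = 0) :
    ∫ x in (0 : ℝ)..b, conj (g x) * u' x = ∫ x in (0 : ℝ)..b, conj (u x) * g' x := by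
  have hc : ∀ {u v g : ℝ → ℂ}, IsTauImage V b u v g → ∀ x ∈ Icc 0 b,
      HasDerivWithinAt (fun x => conj (u x)) (conj (v x)) (Icc 0 b) x := by
    intro u v g h x hx
    exact (Complex.conjCLE : ℂ →L[ℝ] ℂ).hasFDerivAt.comp_hasDerivWithinAt x (h.hasDeriv x hx)
  -- The density of `u' conj v - conj u v'` is `conj u g' - conj g u'`: the first derivatives
  -- cancel, and so do the potential terms because `V` is real. The boundary values vanish by the
  -- Neumann conditions.
  have hd1 := HasDensityOn.deriv_mul h'.hasDeriv h'.hasDensityOn.continuousOn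
    h.hasDensityOn.star
  have hd2 := HasDensityOn.deriv_mul (hc h) h.hasDensityOn.star.continuousOn h'.hasDensityOn
  have e := (hd1.add (hd2.const_mul (-1))).integral_eq hb
  simp only [h0, h1, h0', h1', map_zero, mul_zero, add_zero, sub_zero] at e
  have hIb : (0 : ℝ) ∈ Icc 0 b := ⟨le_rfl, hb⟩
  have hIb' : b ∈ Icc 0 b := ⟨hb, le_rfl⟩
  have hg : ∀ {u v g : ℝ → ℂ}, IsTauImage V b u v g → IntegrableOn g (Icc 0 b) := by
    intro u v g h
    have hVu : IntegrableOn (fun y => (V y : ℂ) * u y) (Icc 0 b) :=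
      ((Complex.continuous_ofReal.comp_continuousOn hV).mul h.continuousOn).integrableOn_Icc
    refine (hVu.sub h.integrable).congr (Eventually.of_forall fun y => ?_)
    simp
  have i1 : IntegrableOn (fun x => conj (g x) * u' x) (Icc 0 b) :=
    IntegrableOn.mul_continuousOn ((Complex.conjCLE : ℂ →L[ℝ] ℂ).integrable_comp (hg h))
      h'.continuousOn isCompact_Icc
  have i2 : IntegrableOn (fun x => conj (u x) * g' x) (Icc 0 b) :=
    IntegrableOn.continuousOn_mul (fun x hx => (hc h x hx).continuousWithinAt) (hg h')
      isCompact_Icc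
  have e2 : ∫ x in (0 : ℝ)..b, (conj (u x) * g' x - conj (g x) * u' x) = 0 := by
    rw [← e]
    congr 1
    funext x
    simp only [map_sub, map_mul, Complex.conj_ofReal]
    ring
  rw [intervalIntegral.integral_sub (intervalIntegrable_of_integrableOn_Icc i2 hIb hIb')
    (intervalIntegrable_of_integrableOn_Icc i1 hIb hIb'), sub_eq_zero] at e2
  exact e2.symm

end

/-! ### Compact integral operators and the Green function -/

noncomputable section

section IntegralOperator

variable {X E : Type*} [TopologicalSpace X] [CompactSpace X] [NormedAddCommGroup E]
  [InnerProductSpace ℂ E]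

/-- The operator `h ↦ (x ↦ ⟪G x, h⟫)`. -/
def innerOperator (G : C(X, E)) : E →L[ℂ] C(X, ℂ) :=
  LinearMap.mkContinuous
    { toFun := fun h => ⟨fun x => inner ℂ (G x) h, by fun_prop⟩
      map_add' := fun h k => by ext x; simp
      map_smul' := fun c h => by ext x; simp }
    ‖G‖ fun h => by
      refine (ContinuousMap.norm_le _ (by positivity)).2 fun x => ?_
      exact (norm_inner_le_norm _ _).trans
        (mul_le_mul_of_nonneg_right (G.norm_coe_le_norm x) (norm_nonneg _))

/-- Arzelà–Ascoli: on the unit ball the images are bounded by `‖G‖`, and they are equicontinuous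
because `⟪G x₀ - G x, h⟫` is at most `‖G x₀ - G x‖`. -/
theorem isCompactOperator_innerOperator (G : C(X, E)) :
    IsCompactOperator (innerOperator G) := by
  let e := ContinuousMap.isometryEquivBoundedOfCompact X ℂ
  let S : Set (BoundedContinuousFunction X ℂ) :=
    (fun h => e (innerOperator G h)) '' Metric.closedBall 0 1
  have hS : IsCompact (closure S) := by
    refine BoundedContinuousFunction.arzela_ascoli (Metric.closedBall 0 ‖G‖)
      (isCompact_closedBall _ _) S ?_ ?_
    · rintro _ x ⟨h, hh, rfl⟩
      rw [mem_closedBall_zero_iff] at hh ⊢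
      refine (norm_inner_le_norm (G x) h).trans ?_
      exact (mul_le_mul (G.norm_coe_le_norm x) hh (norm_nonneg _) (norm_nonneg _)).trans_eq
        (mul_one _)
    · intro x₀
      rw [Metric.equicontinuousAt_iff_right]
      intro ε hε
      filter_upwards [(G.continuous.tendsto x₀).eventually (Metric.ball_mem_nhds _ hε)] with x hx
      rintro ⟨_, h, hh, rfl⟩
      rw [mem_closedBall_zero_iff] at hh
      have h1 : dist (inner ℂ (G x₀) h) (inner ℂ (G x) h) < ε := by
        rw [dist_eq_norm, ← inner_sub_left]
        refine (norm_inner_le_norm _ _).trans_lt ?_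
        rw [dist_comm, dist_eq_norm] at hx
        nlinarith [norm_nonneg (G x₀ - G x)]
      exact h1
  refine (isCompactOperator_iff_image_closedBall_subset_compact
    (innerOperator G).toLinearMap one_pos).2
      ⟨e.symm '' closure S, hS.image e.symm.continuous, ?_⟩
  rintro _ ⟨h, hh, rfl⟩
  exact ⟨_, subset_closure ⟨h, hh, rfl⟩, e.symm_apply_apply _⟩

end IntegralOperator

section L2

variable {b : ℝ}

theorem memLp_of_continuousOn {f : ℝ → ℂ} (hf : ContinuousOn f (Icc 0 b)) :
    MemLp f 2 (volume.restrict (Ioo 0 b)) := by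
  obtain ⟨C, hC⟩ := isCompact_Icc.exists_bound_of_continuousOn hf
  refine MemLp.of_bound ((hf.mono Ioo_subset_Icc_self).aestronglyMeasurable measurableSet_Ioo) C ?_
  filter_upwards [ae_restrict_mem measurableSet_Ioo] with x hx using hC x (Ioo_subset_Icc_self hx)

theorem L2Space.integrableOn (h : L2Space b) : IntegrableOn h (Icc 0 b) := by
  rw [integrableOn_Icc_iff_integrableOn_Ioo]
  exact MemLp.integrable one_le_two (Lp.memLp h)

theorem memLp_IccExtend (hb : 0 ≤ b) (F : C(Icc (0 : ℝ) b, ℂ)) :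
    MemLp (IccExtend hb F) 2 (volume.restrict (Ioo 0 b)) :=
  memLp_of_continuousOn (F.continuous.Icc_extend' (h := hb)).continuousOn

/-- The embedding of the continuous functions on `[0,b]` in `L²(0,b)`. -/
def continuousToL2 (hb : 0 ≤ b) : C(Icc (0 : ℝ) b, ℂ) →L[ℂ] L2Space b :=
  LinearMap.mkContinuous
    ({ toFun := fun F => (memLp_IccExtend hb F).toLp (IccExtend hb F)
       map_add' := fun _ _ => rfl
       map_smul' := fun _ _ => rfl } : C(Icc (0 : ℝ) b, ℂ) →ₗ[ℂ] L2Space b)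
    (measureUnivNNReal (volume.restrict (Ioo (0 : ℝ) b)) ^ ((2 : ℝ≥0∞).toReal)⁻¹ : ℝ) fun F => by
      refine Lp.norm_le_of_ae_bound (norm_nonneg F) ?_
      refine (MemLp.coeFn_toLp (memLp_IccExtend hb F)).mono fun x hx => ?_
      exact (congrArg norm hx).trans_le (F.norm_coe_le_norm _)

theorem coeFn_continuousToL2 (hb : 0 ≤ b) (F : C(Icc (0 : ℝ) b, ℂ)) :
    continuousToL2 hb F =ᵐ[volume.restrict (Ioo 0 b)] IccExtend hb F :=
  MemLp.coeFn_toLp (memLp_IccExtend hb F)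

end L2

section Green

variable {V : ℝ → ℝ} {b : ℝ} {z : ℂ} {u v g : ℝ → ℂ}

/-- The density of the Wronskian is identically zero. Its value is expressed at `b`, where the
second solution of the Green function is normalized. -/
theorem IsClassicalSolution.wronskian_eq (hV : ContinuousOn V (Icc 0 b)) {u' v' : ℝ → ℂ}
    (h : IsClassicalSolution V b z u v) (h' : IsClassicalSolution V b z u' v') :
    ∀ x ∈ Icc 0 b, u x * v' x - v x * u' x = u b * v' b - v b * u' b := by
  have hd1 := HasDensityOn.deriv_mul h.deriv_left h.continuousOn_right (h'.hasDensityOn_right hV)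
  have hd2 := HasDensityOn.deriv_mul h'.deriv_left h'.continuousOn_right (h.hasDensityOn_right hV)
  have hd := hd1.add (hd2.const_mul (-1))
  have h0 : ∀ x ∈ Icc 0 b, u x * v' x - v x * u' x = u 0 * v' 0 - v 0 * u' 0 := by
    intro x hx
    have := hd.eq_integral x hx
    have e : (fun x => v x * v' x + u x * (((V x : ℂ) - z) * u' x) +
        -1 * (v' x * v x + u' x * (((V x : ℂ) - z) * u x))) = fun _ => 0 := by
      funext x
      ring
    rw [e, intervalIntegral.integral_zero] at this
    linear_combination this
  intro x hx
  rw [h0 x hx, h0 b ⟨hx.1.trans hx.2, le_rfl⟩]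

/-- Variation of constants with a solution from each end point. -/
theorem isTauImage_green (hb : 0 ≤ b) (hV : ContinuousOn V (Icc 0 b)) {ξ ξ' η η' : ℝ → ℂ}
    (hξ : IsClassicalSolution V b z ξ ξ') (hη : IsClassicalSolution V b z η η')
    (hξ0 : ξ' 0 = 0) (hηb : η b = 1) (hηb' : η' b = 0) (hD : ξ' b ≠ 0) {h : ℝ → ℂ}
    (hh : IntegrableOn h (Icc 0 b)) :
    ∃ v : ℝ → ℂ, IsTauImage V b
      (fun x => (ξ' b)⁻¹ * (η x * (∫ y in (0 : ℝ)..x, ξ y * h y) + ξ x * ∫ y in x..b, η y * h y)) v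
      (fun x => z * ((ξ' b)⁻¹ * (η x * (∫ y in (0 : ℝ)..x, ξ y * h y) +
        ξ x * ∫ y in x..b, η y * h y)) + h x) ∧ v 0 = 0 ∧ v b = 0 := by
  have h0 : (0 : ℝ) ∈ Icc 0 b := ⟨le_rfl, hb⟩
  have hb' : b ∈ Icc 0 b := ⟨hb, le_rfl⟩
  have iξ : IntegrableOn (fun y => ξ y * h y) (Icc 0 b) :=
    hh.continuousOn_mul hξ.continuousOn_left isCompact_Icc
  have iη : IntegrableOn (fun y => η y * h y) (Icc 0 b) :=
    hh.continuousOn_mul hη.continuousOn_left isCompact_Icc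
  set D := ξ' b with hDdef
  set A : ℝ → ℂ := fun x => ∫ y in (0 : ℝ)..x, ξ y * h y with hA
  set B : ℝ → ℂ := fun x => ∫ y in x..b, η y * h y with hB
  have dA : HasDensityOn b A (fun y => ξ y * h y) := ⟨iξ, fun x hx => by simp [hA]⟩
  have dB : HasDensityOn b B (fun y => -1 * (η y * h y)) := by
    refine ⟨iη.const_mul (-1), fun x hx => ?_⟩
    have := intervalIntegral.integral_add_adjacent_intervals
      (intervalIntegrable_of_integrableOn_Icc iη h0 hx)
      (intervalIntegrable_of_integrableOn_Icc iη hx hb')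
    rw [intervalIntegral.integral_const_mul]
    simp only [hB]
    rw [← this]
    ring
  -- When `U` is differentiated, the terms containing `h` cancel. When `W` is differentiated, they
  -- combine to the Wronskian `-D` times `h`; this is what the factor `D⁻¹` compensates.
  have hW : ∀ x ∈ Icc 0 b, η' x * ξ x - ξ' x * η x = -D := by
    intro x hx
    have := hξ.wronskian_eq hV hη x hx
    rw [hηb, hηb'] at this
    linear_combination this
  set U : ℝ → ℂ := fun x => D⁻¹ * (η x * A x + ξ x * B x) with hU
  set W : ℝ → ℂ := fun x => D⁻¹ * (η' x * A x + ξ' x * B x) with hWdef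
  have dU : HasDensityOn b U W := by
    refine (((HasDensityOn.deriv_mul hη.deriv_left hη.continuousOn_right dA).add
      (HasDensityOn.deriv_mul hξ.deriv_left hξ.continuousOn_right dB)).const_mul D⁻¹).congr
      (fun _ _ => rfl) fun x _ => ?_
    simp only [hWdef]
    ring
  have dW : HasDensityOn b W (fun x => (V x : ℂ) * U x - (z * U x + h x)) := by
    refine (((HasDensityOn.deriv_mul hη.deriv_right (hη.continuousOn_deriv hV) dA).add
      (HasDensityOn.deriv_mul hξ.deriv_right (hξ.continuousOn_deriv hV) dB)).const_mul D⁻¹).congr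
      (fun _ _ => rfl) fun x hx => ?_
    have e := hW x hx
    have e2 : D⁻¹ * D = 1 := inv_mul_cancel₀ hD
    simp only [hU]
    linear_combination (-D⁻¹ * h x) * e + h x * e2
  refine ⟨W, ⟨fun x hx => dU.hasDerivWithinAt dW.continuousOn hx, dW.integrable,
    dW.eq_integral⟩, ?_, ?_⟩
  · simp [hWdef, hA, hξ0]
  · simp [hWdef, hB, hηb']

variable (hb : 0 < b) (hV : ContinuousOn V (Icc 0 b))
include hb hV

/-- The resolvent, as an integral operator, when `z` is no zero of the characteristic function. -/
theorem exists_green_operator (hD : xiDeriv V b b z ≠ 0) :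
    ∃ T : L2Space b →L[ℂ] L2Space b, IsCompactOperator T ∧ ∀ h : L2Space b, ∃ u v : ℝ → ℂ,
      T h =ᵐ[volume.restrict (Ioo 0 b)] u ∧ IsTauImage V b u v (fun x => z * u x + h x) ∧
        v 0 = 0 ∧ v b = 0 := by
  obtain ⟨hξ, -, hξ0⟩ := xi_spec hb hV z
  obtain ⟨η, η', hη, hηb, hηb'⟩ := exists_right_solution hb hV z
  set D := xiDeriv V b b z with hDdef
  set ξ : ℝ → ℂ := fun x => xi V b x z with hξdef
  have cξ : Continuous fun x : Icc (0 : ℝ) b => ξ x :=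
    continuousOn_iff_continuous_domRestrict.1 hξ.continuousOn_left
  have cη : Continuous fun x : Icc (0 : ℝ) b => η x :=
    continuousOn_iff_continuous_domRestrict.1 hη.continuousOn_left
  -- The Green function `D⁻¹ ξ(min) η(max)`, continuous on the closed square. It is conjugated
  -- because the inner product is conjugate-linear in its first slot.
  let k : C(Icc (0 : ℝ) b × Icc (0 : ℝ) b, ℂ) :=
    ⟨fun p => conj (D⁻¹ * (ξ (min p.1 p.2 : Icc (0 : ℝ) b) * η (max p.1 p.2 : Icc (0 : ℝ) b))), by
      refine Complex.continuous_conj.comp (continuous_const.mul (Continuous.mul ?_ ?_))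
      · exact cξ.comp (continuous_fst.min continuous_snd)
      · exact cη.comp (continuous_fst.max continuous_snd)⟩
  let G : C(Icc (0 : ℝ) b, L2Space b) := (continuousToL2 hb.le : C(_, _)).comp k.curry
  refine ⟨(continuousToL2 hb.le).comp (innerOperator G),
    (isCompactOperator_innerOperator G).clm_comp (continuousToL2 hb.le), fun h => ?_⟩
  obtain ⟨v, hv, hv0, hvb⟩ := isTauImage_green hb.le hV hξ hη hξ0 hηb hηb' hD
    (L2Space.integrableOn h)
  refine ⟨_, v, ?_, hv, hv0, hvb⟩
  refine (coeFn_continuousToL2 hb.le _).trans ?_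
  filter_upwards [ae_restrict_mem measurableSet_Ioo] with x hx
  have hx' := Ioo_subset_Icc_self hx
  rw [IccExtend_of_mem hb.le _ hx']
  change inner ℂ (G ⟨x, hx'⟩) h = _
  have e1 : inner ℂ (G ⟨x, hx'⟩) h = ∫ y in (0 : ℝ)..b, D⁻¹ * (ξ (min x y) * η (max x y)) * h y := by
    rw [← innerL2_eq_inner, innerL2, intervalIntegral.integral_of_le hb.le,
      integral_Ioc_eq_integral_Ioo]
    refine integral_congr_ae ?_
    filter_upwards [coeFn_continuousToL2 hb.le (k.curry ⟨x, hx'⟩),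
      ae_restrict_mem measurableSet_Ioo] with y hy hyI
    have : G ⟨x, hx'⟩ y = IccExtend hb.le (k.curry ⟨x, hx'⟩) y := hy
    rw [this, IccExtend_of_mem hb.le _ (Ioo_subset_Icc_self hyI)]
    simp only [ContinuousMap.curry_apply, k, ContinuousMap.coe_mk, Complex.conj_conj]
    rfl
  rw [e1]
  have i1 : IntegrableOn (fun y => ξ y * h y) (Icc 0 b) :=
    (L2Space.integrableOn h).continuousOn_mul hξ.continuousOn_left isCompact_Icc
  have i2 : IntegrableOn (fun y => η y * h y) (Icc 0 b) :=
    (L2Space.integrableOn h).continuousOn_mul hη.continuousOn_left isCompact_Icc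
  have h0 : (0 : ℝ) ∈ Icc 0 b := ⟨le_rfl, hb.le⟩
  have hb' : b ∈ Icc 0 b := ⟨hb.le, le_rfl⟩
  have j1 := intervalIntegrable_of_integrableOn_Icc i1 h0 hx'
  have j2 := intervalIntegrable_of_integrableOn_Icc i2 hx' hb'
  have c1 : EqOn (fun y => (D⁻¹ * η x) * (ξ y * h y))
      (fun y => D⁻¹ * (ξ (min x y) * η (max x y)) * h y) (uIcc 0 x) := by
    intro y hy
    rw [uIcc_of_le hx'.1] at hy
    simp only [min_eq_right hy.2, max_eq_left hy.2]
    ring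
  have c2 : EqOn (fun y => (D⁻¹ * ξ x) * (η y * h y))
      (fun y => D⁻¹ * (ξ (min x y) * η (max x y)) * h y) (uIcc x b) := by
    intro y hy
    rw [uIcc_of_le hx'.2] at hy
    simp only [min_eq_left hy.1, max_eq_right hy.1]
    ring
  rw [← intervalIntegral.integral_add_adjacent_intervals
    ((j1.const_mul _).congr (c1.mono uIoc_subset_uIcc))
    ((j2.const_mul _).congr (c2.mono uIoc_subset_uIcc)),
    ← intervalIntegral.integral_congr c1, ← intervalIntegral.integral_congr c2,
    intervalIntegral.integral_const_mul, intervalIntegral.integral_const_mul]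
  ring

end Green
end

/-! ### The Neumann spectrum and its eigenfunctions -/

noncomputable section

section L2

variable {b : ℝ}

/-- The class in `L²(0,b)` of a function which is continuous on `[0,b]`. -/
def toL2 (f : ℝ → ℂ) (hf : ContinuousOn f (Icc 0 b)) : L2Space b :=
  (memLp_of_continuousOn hf).toLp f

theorem coeFn_toL2 (f : ℝ → ℂ) (hf : ContinuousOn f (Icc 0 b)) :
    toL2 f hf =ᵐ[volume.restrict (Ioo 0 b)] f :=
  MemLp.coeFn_toLp (memLp_of_continuousOn hf)

/-- This permits reading point values, including those at the end points, from classes in `L²(0,b)`.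
-/
theorem eqOn_of_ae_eq (hb : 0 < b) {f g : ℝ → ℂ} (hf : ContinuousOn f (Icc 0 b))
    (hg : ContinuousOn g (Icc 0 b)) (h : f =ᵐ[volume.restrict (Ioo 0 b)] g) :
    EqOn f g (Icc 0 b) := by
  have := Measure.eqOn_open_of_ae_eq h isOpen_Ioo (hf.mono Ioo_subset_Icc_self)
    (hg.mono Ioo_subset_Icc_self)
  exact this.of_subset_closure hf hg Ioo_subset_Icc_self (by rw [closure_Ioo hb.ne])

theorem inner_eq_intervalIntegral (hb : 0 ≤ b) {φ ψ : L2Space b} {f g : ℝ → ℂ}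
    (hf : φ =ᵐ[volume.restrict (Ioo 0 b)] f) (hg : ψ =ᵐ[volume.restrict (Ioo 0 b)] g) :
    inner ℂ φ ψ = ∫ x in (0 : ℝ)..b, conj (f x) * g x := by
  rw [← innerL2_eq_inner, innerL2, intervalIntegral.integral_of_le hb, integral_Ioc_eq_integral_Ioo]
  refine integral_congr_ae ?_
  filter_upwards [hf, hg] with x h1 h2
  rw [h1, h2]

theorem norm_sq_eq_intervalIntegral (hb : 0 ≤ b) {φ : L2Space b} {f : ℝ → ℂ}
    (hf : φ =ᵐ[volume.restrict (Ioo 0 b)] f) :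
    ‖φ‖ ^ 2 = ∫ x in (0 : ℝ)..b, ‖f x‖ ^ 2 := by
  have h := inner_eq_intervalIntegral hb hf hf
  rw [inner_self_eq_norm_sq_to_K] at h
  have h2 : (fun x => conj (f x) * f x) = fun x => ((‖f x‖ ^ 2 : ℝ) : ℂ) := by
    funext x
    rw [mul_comm, Complex.mul_conj']
    push_cast
    rfl
  rw [h2, intervalIntegral.integral_ofReal] at h
  refine Complex.ofReal_injective (Eq.trans ?_ h)
  push_cast
  rfl

end L2

section Graph

variable {V : ℝ → ℝ} {b : ℝ} {z : ℂ}

theorem mem_schrodingerGraph_neumann {p : L2Space b × L2Space b} :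
    p ∈ schrodingerGraph V b (Real.pi / 2) ↔ ∃ u v g : ℝ → ℂ,
      p.1 =ᵐ[volume.restrict (Ioo 0 b)] u ∧ p.2 =ᵐ[volume.restrict (Ioo 0 b)] g ∧
      IsTauImage V b u v g ∧ v 0 = 0 ∧ v b = 0 := by
  change (∃ u v g : ℝ → ℂ, _) ↔ _
  simp

theorem schrodingerGraph_symmetric (hb : 0 ≤ b) (hV : ContinuousOn V (Icc 0 b))
    {p q : L2Space b × L2Space b} (hp : p ∈ schrodingerGraph V b (Real.pi / 2))
    (hq : q ∈ schrodingerGraph V b (Real.pi / 2)) : inner ℂ p.2 q.1 = inner ℂ p.1 q.2 := by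
  obtain ⟨u, v, g, h1, h2, h3, h4, h5⟩ := mem_schrodingerGraph_neumann.1 hp
  obtain ⟨u', v', g', h1', h2', h3', h4', h5'⟩ := mem_schrodingerGraph_neumann.1 hq
  rw [inner_eq_intervalIntegral hb h2 h1', inner_eq_intervalIntegral hb h1 h2']
  exact h3.integral_conj_mul hb hV h3' h4 h5 h4' h5'

/-- The function `g` enters only through integrals. This is needed because the graph fixes `τ φ`
only up to null sets. -/
theorem IsTauImage.congr_ae {u v g g' : ℝ → ℂ} (h : IsTauImage V b u v g)
    (hg : g =ᵐ[volume.restrict (Ioo 0 b)] g') : IsTauImage V b u v g' := by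
  rw [Measure.restrict_congr_set Ioo_ae_eq_Icc] at hg
  have hg' : (fun y => (V y : ℂ) * u y - g y) =ᵐ[volume.restrict (Icc 0 b)]
      fun y => (V y : ℂ) * u y - g' y := by
    filter_upwards [hg] with y hy
    rw [hy]
  refine ⟨h.hasDeriv, h.integrable.congr hg', fun x hx => ?_⟩
  rw [h.eq_integral x hx]
  congr 1
  refine intervalIntegral.integral_congr_ae ?_
  filter_upwards [(ae_restrict_iff' measurableSet_Icc).1 hg'] with y hy hyx
  rw [uIoc_of_le hx.1] at hyx
  exact hy ⟨hyx.1.le, hyx.2.trans hx.2⟩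

variable (hb : 0 < b) (hV : ContinuousOn V (Icc 0 b))

/-- The class of `ξ(·, z)` in `L²(0,b)`. -/
def xiL2 (z : ℂ) : L2Space b := toL2 (fun x => xi V b x z) (xi_spec hb hV z).1.continuousOn_left

theorem coeFn_xiL2 (z : ℂ) :
    xiL2 hb hV z =ᵐ[volume.restrict (Ioo 0 b)] fun x => xi V b x z :=
  coeFn_toL2 _ _

theorem xiL2_ne_zero (z : ℂ) : xiL2 hb hV z ≠ 0 := by
  intro h
  obtain ⟨h1, h2, -⟩ := xi_spec hb hV z
  have h3 : (fun x => xi V b x z) =ᵐ[volume.restrict (Ioo 0 b)] fun _ => (0 : ℂ) := by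
    refine (coeFn_xiL2 hb hV z).symm.trans ?_
    rw [h]
    exact Lp.coeFn_zero _ _ _
  have h4 := eqOn_of_ae_eq hb h1.continuousOn_left continuousOn_const h3 ⟨le_rfl, hb.le⟩
  simp [h2] at h4

theorem xiL2_mem_graph (hz : xiDeriv V b b z = 0) :
    (xiL2 hb hV z, z • xiL2 hb hV z) ∈ schrodingerGraph V b (Real.pi / 2) := by
  obtain ⟨h1, -, h3⟩ := xi_spec hb hV z
  refine mem_schrodingerGraph_neumann.2 ⟨_, _, fun x => z * xi V b x z, coeFn_xiL2 hb hV z, ?_,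
    h1.isTauImage hV, h3, hz⟩
  filter_upwards [coeFn_xiL2 hb hV z, Lp.coeFn_smul z (xiL2 hb hV z)] with x hx hx2
  rw [hx2, Pi.smul_apply, hx, smul_eq_mul]

/-- The representative of `φ` is a classical solution with `u'(0) = 0`, hence `u(0) ξ`, and the
Neumann condition at `b` is the second assertion. Off the zeros of `ξ'(b,·)` it forces `φ = 0`;
otherwise it identifies eigenvectors. -/
theorem exists_eq_smul_xiL2 {φ : L2Space b}
    (h : (φ, z • φ) ∈ schrodingerGraph V b (Real.pi / 2)) :
    ∃ c : ℂ, φ = c • xiL2 hb hV z ∧ c * xiDeriv V b b z = 0 := by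
  obtain ⟨u, v, g, h1, h2, h3, h4, h5⟩ := mem_schrodingerGraph_neumann.1 h
  have hg : g =ᵐ[volume.restrict (Ioo 0 b)] fun x => z * u x := by
    refine h2.symm.trans ?_
    filter_upwards [h1, Lp.coeFn_smul z φ] with x hx hx2
    rw [hx2, Pi.smul_apply, hx, smul_eq_mul]
  have hs := (h3.congr_ae hg).isClassicalSolution hV
  have he := hs.eq_xi hb hV h4
  refine ⟨u 0, Lp.ext (h1.trans ?_), ?_⟩
  · filter_upwards [coeFn_xiL2 hb hV z, Lp.coeFn_smul (u 0) (xiL2 hb hV z),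
      ae_restrict_mem measurableSet_Ioo] with x hx hx2 hxI
    rw [hx2, Pi.smul_apply, hx, smul_eq_mul]
    exact (he x (Ioo_subset_Icc_self hxI)).1
  · rw [← (he b ⟨hb.le, le_rfl⟩).2, h5]

include hb hV

theorem exists_compact_resolvent (hD : xiDeriv V b b z ≠ 0) :
    ∃ T : L2Space b →L[ℂ] L2Space b, IsCompactOperator T ∧
      ∀ h, (T h, z • T h + h) ∈ schrodingerGraph V b (Real.pi / 2) := by
  obtain ⟨T, hT, hTg⟩ := exists_green_operator hb hV hD
  refine ⟨T, hT, fun h => ?_⟩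
  obtain ⟨u, v, h1, h2, h3, h4⟩ := hTg h
  refine mem_schrodingerGraph_neumann.2 ⟨u, v, _, h1, ?_, h2, h3, h4⟩
  filter_upwards [h1, Lp.coeFn_smul z (T h), Lp.coeFn_add (z • T h) h] with x hx hx2 hx3
  rw [hx3, Pi.add_apply, hx2, Pi.smul_apply, hx, smul_eq_mul]

/-- The Neumann spectrum is the zero set of `z ↦ ξ'(b, z)`. -/
theorem mem_samplingPoints_neumann :
    z ∈ samplingPoints V b (Real.pi / 2) ↔ xiDeriv V b b z = 0 := by
  constructor
  · intro hz
    by_contra hD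
    obtain ⟨T, -, hT⟩ := exists_compact_resolvent hb hV hD
    refine hz ⟨T, fun h => ?_, fun φ => ?_⟩
    · have := hT h
      rw [← schrodingerOperator_graph V hb, LinearPMap.mem_graph_iff] at this
      obtain ⟨y, hy1, hy2⟩ := this
      simp only at hy1 hy2
      refine ⟨hy1 ▸ y.2, ?_⟩
      have e : (⟨T h, hy1 ▸ y.2⟩ : (schrodingerOperator V b (Real.pi / 2)).domain) = y :=
        Subtype.ext hy1.symm
      rw [e, hy2]
      abel
    -- `T` is a left inverse as well: the difference of `T k` and `φ` solves the homogeneous Neumann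
    -- problem at `z`, which has only the zero solution.
    · set k := schrodingerOperator V b (Real.pi / 2) φ - z • (φ : L2Space b) with hk
      have h1 : ((φ : L2Space b), schrodingerOperator V b (Real.pi / 2) φ) ∈
          schrodingerGraph V b (Real.pi / 2) := by
        rw [← schrodingerOperator_graph V hb]
        exact LinearPMap.mem_graph _ φ
      have h2 := Submodule.sub_mem _ (hT k) h1
      have h3 : ((T k, z • T k + k) - ((φ : L2Space b), schrodingerOperator V b (Real.pi / 2) φ)) =
          (T k - φ, z • (T k - (φ : L2Space b))) := by
        refine Prod.ext rfl ?_
        simp only [Prod.snd_sub, hk, smul_sub]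
        abel
      rw [h3] at h2
      obtain ⟨c, hc1, hc2⟩ := exists_eq_smul_xiL2 hb hV h2
      rw [mul_eq_zero, or_iff_left hD] at hc2
      rw [hc2, zero_smul, sub_eq_zero] at hc1
      exact hc1
  -- Here `ξ(·,z)` is a nonzero eigenvector, which a left inverse of `H - z` would have to recover
  -- from `0`.
  · rintro hD ⟨R, -, hR⟩
    have h1 := xiL2_mem_graph hb hV hD
    rw [← schrodingerOperator_graph V hb, LinearPMap.mem_graph_iff] at h1
    obtain ⟨y, hy1, hy2⟩ := h1
    simp only at hy1 hy2
    have h2 := hR y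
    rw [hy2, hy1, sub_self, map_zero] at h2
    exact xiL2_ne_zero hb hV z h2.symm

/-- Symmetry applied to the eigenvector `ξ(·,z)` with itself gives `conj z ‖ξ‖² = z ‖ξ‖²`. -/
theorem conj_eq_of_mem_samplingPoints (hz : z ∈ samplingPoints V b (Real.pi / 2)) :
    conj z = z := by
  have h1 := xiL2_mem_graph hb hV ((mem_samplingPoints_neumann hb hV).1 hz)
  have h2 := schrodingerGraph_symmetric hb.le hV h1 h1
  simp only [inner_smul_left, inner_smul_right] at h2
  exact mul_right_cancel₀ (inner_self_ne_zero.2 (xiL2_ne_zero hb hV z)) h2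

theorem inner_xiL2_eq_zero {s t : ℂ} (hs : s ∈ samplingPoints V b (Real.pi / 2))
    (ht : t ∈ samplingPoints V b (Real.pi / 2)) (hst : s ≠ t) :
    inner ℂ (xiL2 hb hV s) (xiL2 hb hV t) = 0 := by
  have h1 := xiL2_mem_graph hb hV ((mem_samplingPoints_neumann hb hV).1 hs)
  have h2 := xiL2_mem_graph hb hV ((mem_samplingPoints_neumann hb hV).1 ht)
  have h3 := schrodingerGraph_symmetric hb.le hV h1 h2
  simp only [inner_smul_left, inner_smul_right, conj_eq_of_mem_samplingPoints hb hV hs] at h3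
  by_contra h4
  exact hst (mul_right_cancel₀ h4 h3)

/-- The normalized Neumann eigenfunctions. -/
def eigenL2 (t : samplingPoints V b (Real.pi / 2)) : L2Space b :=
  ((‖xiL2 hb hV t‖⁻¹ : ℝ) : ℂ) • xiL2 hb hV t

theorem orthonormal_eigenL2 : Orthonormal ℂ (eigenL2 hb hV) := by
  refine ⟨fun t => ?_, fun s t hst => ?_⟩
  · have := norm_ne_zero_iff.2 (xiL2_ne_zero hb hV t)
    rw [eigenL2, norm_smul, Complex.norm_real, norm_inv, norm_norm, inv_mul_cancel₀ this]
  · simp only [eigenL2, inner_smul_left, inner_smul_right]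
    rw [inner_xiL2_eq_zero hb hV s.2 t.2 (fun h => hst (Subtype.ext h))]
    simp

/-- Completeness of the eigenfunctions. -/
theorem span_eigenL2_orthogonal_eq_bot {μ : ℝ} (hμ : xiDeriv V b b μ ≠ 0) :
    (Submodule.span ℂ (range (eigenL2 hb hV)))ᗮ = ⊥ := by
  obtain ⟨T, hTc, hT⟩ := exists_compact_resolvent hb hV hμ
  -- Symmetry of the graph passes to `T` because `μ` is real: the terms with `μ` on both sides
  -- coincide.
  have hsym : T.IsSymmetric := by
    intro h k
    have := schrodingerGraph_symmetric hb.le hV (hT h) (hT k)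
    simp only [inner_add_left, inner_add_right, inner_smul_left, inner_smul_right,
      Complex.conj_ofReal] at this
    exact (add_left_cancel this).symm
  rw [eq_bot_iff, ← ContinuousLinearMap.orthogonalComplement_iSup_eigenspaces_eq_bot hTc hsym]
  refine Submodule.orthogonal_le (iSup_le fun κ h hh => ?_)
  rw [Module.End.mem_eigenspace_iff] at hh
  change T h = κ • h at hh
  have hg := hT h
  rw [hh] at hg
  -- If `T h = 0`, then `(0, h)` lies in the graph of an operator, so `h = 0`. An eigenvalue `κ ≠ 0`
  -- of `T` corresponds to the eigenvalue `μ + κ⁻¹` of `H`.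
  by_cases hκ : κ = 0
  · rw [hκ, zero_smul, smul_zero, zero_add, ← schrodingerOperator_graph V hb] at hg
    rw [LinearPMap.graph_fst_eq_zero_snd _ hg rfl]
    exact Submodule.zero_mem _
  · have hg2 := Submodule.smul_mem _ κ⁻¹ hg
    have e : κ⁻¹ • (κ • h, (μ : ℂ) • κ • h + h) = (h, (μ + κ⁻¹) • h) := by
      refine Prod.ext ?_ ?_
      · simp [smul_smul, inv_mul_cancel₀ hκ]
      · simp only [Prod.smul_snd, smul_add, add_smul, smul_smul]
        congr 2
        field_simp
    rw [e] at hg2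
    obtain ⟨c, hc1, hc2⟩ := exists_eq_smul_xiL2 hb hV hg2
    rcases mul_eq_zero.1 hc2 with hc | hD
    · rw [hc1, hc, zero_smul]
      exact Submodule.zero_mem _
    · have ht := (mem_samplingPoints_neumann hb hV).2 hD
      have hne : ((‖xiL2 hb hV (μ + κ⁻¹)‖⁻¹ : ℝ) : ℂ) ≠ 0 :=
        Complex.ofReal_ne_zero.2 (inv_ne_zero (norm_ne_zero_iff.2 (xiL2_ne_zero hb hV _)))
      have e2 : xiL2 hb hV (μ + κ⁻¹) =
          ((‖xiL2 hb hV (μ + κ⁻¹)‖⁻¹ : ℝ) : ℂ)⁻¹ • eigenL2 hb hV ⟨_, ht⟩ := by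
        rw [eigenL2, smul_smul, inv_mul_cancel₀ hne, one_smul]
      rw [hc1, e2]
      exact Submodule.smul_mem _ _ (Submodule.smul_mem _ _ (Submodule.subset_span ⟨_, rfl⟩))

end Graph
end

/-! ### Sobolev and energy estimates; summability over the spectrum -/

noncomputable section

/-- The Cauchy-Schwarz inequality against a constant. -/
theorem sq_integral_le {b : ℝ} (hb : 0 < b) {f : ℝ → ℝ} (hf : ContinuousOn f (Icc 0 b)) :
    (∫ x in (0 : ℝ)..b, f x) ^ 2 ≤ b * ∫ x in (0 : ℝ)..b, f x ^ 2 := by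
  rw [← uIcc_of_le hb.le] at hf
  set m := ∫ x in (0 : ℝ)..b, f x with hm
  -- Since `m / b` is the mean of `f`, this is the nonnegativity of the variance, scaled by `b ^ 2`.
  have h1 : 0 ≤ ∫ x in (0 : ℝ)..b, (b * f x - m) ^ 2 :=
    intervalIntegral.integral_nonneg hb.le fun x _ => sq_nonneg _
  have h2 : ∫ x in (0 : ℝ)..b, (b * f x - m) ^ 2 =
      b ^ 2 * (∫ x in (0 : ℝ)..b, f x ^ 2) - 2 * b * m * m + m ^ 2 * b := by
    have e : (fun x => (b * f x - m) ^ 2) =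
        fun x => (b ^ 2 * f x ^ 2 - 2 * b * m * f x) + m ^ 2 := by
      funext x
      ring
    rw [e, intervalIntegral.integral_add, intervalIntegral.integral_sub,
      intervalIntegral.integral_const_mul, intervalIntegral.integral_const_mul,
      intervalIntegral.integral_const, ← hm]
    · simp only [smul_eq_mul]
      ring
    · exact (continuousOn_const.mul (hf.pow 2)).intervalIntegrable
    · exact (continuousOn_const.mul hf).intervalIntegrable
    · exact ((continuousOn_const.mul (hf.pow 2)).sub
        (continuousOn_const.mul hf)).intervalIntegrable
    · exact intervalIntegrable_const
  rw [h2] at h1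
  have h3 : 0 ≤ b * (b * (∫ x in (0 : ℝ)..b, f x ^ 2) - m ^ 2) := by nlinarith
  have := nonneg_of_mul_nonneg_right h3 hb
  linarith

/-- The Sobolev inequality on an interval. -/
theorem norm_sq_le_sobolev {b : ℝ} (hb : 0 < b) {u v : ℝ → ℂ} (h : HasDensityOn b u v)
    (hv : ContinuousOn v (Icc 0 b)) {x : ℝ} (hx : x ∈ Icc 0 b) :
    ‖u x‖ ^ 2 ≤ (2 / b + 2 * b) *
      ((∫ y in (0 : ℝ)..b, ‖u y‖ ^ 2) + ∫ y in (0 : ℝ)..b, ‖v y‖ ^ 2) := by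
  have h0 : (0 : ℝ) ∈ Icc 0 b := ⟨le_rfl, hb.le⟩
  have hb' : b ∈ Icc 0 b := ⟨hb.le, le_rfl⟩
  set G := ∫ y in (0 : ℝ)..b, ‖v y‖ with hG
  set I := ∫ y in (0 : ℝ)..b, ‖u y‖ ^ 2 with hI
  set J := ∫ y in (0 : ℝ)..b, ‖v y‖ ^ 2 with hJ
  have hGJ : G ^ 2 ≤ b * J := sq_integral_le hb hv.norm
  have hvi : IntegrableOn (fun y => ‖v y‖) (Icc 0 b) := hv.norm.integrableOn_Icc
  -- Compare `u x` with `u y` through the integral of `v`, then average over `y`. The averaging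
  -- produces `2 / b`, and the Cauchy-Schwarz inequality produces `2 * b`.
  have h1 : ∀ y ∈ Icc 0 b, ‖u x‖ ^ 2 ≤ 2 * ‖u y‖ ^ 2 + 2 * (b * J) := by
    intro y hy
    have h2 : ‖u x - u y‖ ≤ G := by
      rw [h.sub_eq hy hx]
      refine intervalIntegral.norm_integral_le_abs_integral_norm.trans ?_
      rw [intervalIntegral.abs_integral_eq_abs_integral_uIoc,
        abs_of_nonneg (integral_nonneg fun _ => norm_nonneg _), hG,
        intervalIntegral.integral_of_le hb.le, ← integral_Icc_eq_integral_Ioc]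
      exact setIntegral_mono_set hvi (Eventually.of_forall fun _ => norm_nonneg _)
        (uIoc_subset_uIcc.trans (uIcc_subset_Icc hy hx)).eventuallyLE
    have h3 : ‖u x‖ ≤ ‖u y‖ + G := by
      have := norm_add_le (u y) (u x - u y)
      rw [add_sub_cancel] at this
      linarith
    have : ‖u x‖ ^ 2 ≤ (‖u y‖ + G) ^ 2 := pow_le_pow_left₀ (norm_nonneg _) h3 2
    nlinarith [sq_nonneg (‖u y‖ - G)]
  have huc : ContinuousOn (fun y => ‖u y‖ ^ 2) (uIcc 0 b) := by
    rw [uIcc_of_le hb.le]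
    exact h.continuousOn.norm.pow 2
  have hu2 : ContinuousOn (fun y => 2 * ‖u y‖ ^ 2) (uIcc 0 b) := continuousOn_const.mul huc
  have h4 := intervalIntegral.integral_mono_on (μ := volume) (g := fun y => 2 * ‖u y‖ ^ 2 +
    2 * (b * J)) hb.le intervalIntegrable_const
    (hu2.intervalIntegrable.add intervalIntegrable_const) h1
  rw [intervalIntegral.integral_const, intervalIntegral.integral_add
    hu2.intervalIntegrable intervalIntegrable_const,
    intervalIntegral.integral_const_mul, intervalIntegral.integral_const, ← hI] at h4
  simp only [sub_zero, smul_eq_mul] at h4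
  have hI0 : 0 ≤ I := intervalIntegral.integral_nonneg hb.le fun _ _ => by positivity
  have hJ0 : 0 ≤ J := intervalIntegral.integral_nonneg hb.le fun _ _ => by positivity
  have h5 : ‖u x‖ ^ 2 ≤ 2 / b * I + 2 * b * J := by
    rw [← mul_le_mul_iff_right₀ hb]
    refine h4.trans (le_of_eq ?_)
    field_simp
  have : 0 ≤ 2 / b * J + 2 * b * I := by positivity
  linarith

section Energy

variable {V : ℝ → ℝ} {b μ : ℝ}

/-- The energy form dominates the Sobolev norm. -/
theorem energy_le (hb : 0 < b) (hV : ContinuousOn V (Icc 0 b)) (hμ : ∀ x ∈ Icc 0 b, μ + 1 ≤ V x)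
    {φ ψ : L2Space b} {u v g : ℝ → ℂ} (hφ : φ =ᵐ[volume.restrict (Ioo 0 b)] u)
    (hψ : ψ =ᵐ[volume.restrict (Ioo 0 b)] g) (h : IsTauImage V b u v g) (h0 : v 0 = 0)
    (h1 : v b = 0) :
    (∫ y in (0 : ℝ)..b, ‖u y‖ ^ 2) + ∫ y in (0 : ℝ)..b, ‖v y‖ ^ 2 ≤
      (inner ℂ φ (ψ - (μ : ℂ) • φ)).re := by
  have hI0 : (0 : ℝ) ∈ Icc 0 b := ⟨le_rfl, hb.le⟩
  have hIb : b ∈ Icc 0 b := ⟨hb.le, le_rfl⟩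
  have hvc : ContinuousOn v (Icc 0 b) := h.hasDensityOn.continuousOn
  have hd := HasDensityOn.deriv_mul (F := fun x => conj (u x)) (F' := fun x => conj (v x))
    (fun x hx => (Complex.conjCLE : ℂ →L[ℝ] ℂ).hasFDerivAt.comp_hasDerivWithinAt x
      (h.hasDeriv x hx)) h.hasDensityOn.star.continuousOn h.hasDensityOn
  have e1 := hd.integral_eq hb.le
  rw [h0, h1, mul_zero, mul_zero, sub_zero] at e1
  have hφψ : ψ - (μ : ℂ) • φ =ᵐ[volume.restrict (Ioo 0 b)] fun x => g x - μ * u x := by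
    filter_upwards [hφ, hψ, Lp.coeFn_sub ψ ((μ : ℂ) • φ), Lp.coeFn_smul (μ : ℂ) φ]
      with x a1 a2 a3 a4
    rw [a3, Pi.sub_apply, a4, Pi.smul_apply, a1, a2, smul_eq_mul]
  rw [inner_eq_intervalIntegral hb.le hφ hφψ]
  have cr : ContinuousOn (fun x => ‖v x‖ ^ 2 + (V x - μ) * ‖u x‖ ^ 2) (Icc 0 b) :=
    (hvc.norm.pow 2).add ((hV.sub continuousOn_const).mul (h.continuousOn.norm.pow 2))
  have hcr : IntegrableOn (fun x => ((‖v x‖ ^ 2 + (V x - μ) * ‖u x‖ ^ 2 : ℝ) : ℂ)) (Icc 0 b) :=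
    (Complex.continuous_ofReal.comp_continuousOn cr).integrableOn_Icc
  have hsq : ∀ w : ℂ, conj w * w = ((‖w‖ ^ 2 : ℝ) : ℂ) := fun w => by
    rw [mul_comm, Complex.mul_conj']
    push_cast
    rfl
  -- Subtracting the vanishing integral of the density of `conj u v` turns the form into the
  -- integral of `‖v‖² + (V - μ)‖u‖²`, where `V - μ ≥ 1`.
  have e2 : ∫ x in (0 : ℝ)..b, conj (u x) * (g x - μ * u x) =
      ((∫ x in (0 : ℝ)..b, (‖v x‖ ^ 2 + (V x - μ) * ‖u x‖ ^ 2) : ℝ) : ℂ) := by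
    rw [← intervalIntegral.integral_ofReal, ← sub_zero (∫ x in (0 : ℝ)..b, ((_ : ℝ) : ℂ)), ← e1,
      ← intervalIntegral.integral_sub (intervalIntegrable_of_integrableOn_Icc hcr hI0 hIb)
        (hd.intervalIntegrable hI0 hIb)]
    congr 1
    funext x
    push_cast
    have a1 := hsq (u x)
    have a2 := hsq (v x)
    push_cast at a1 a2
    linear_combination a2 + ((V x : ℂ) - μ) * a1
  rw [e2, Complex.ofReal_re]
  rw [← uIcc_of_le hb.le] at cr
  have cu : ContinuousOn (fun x => ‖u x‖ ^ 2) (uIcc 0 b) := by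
    rw [uIcc_of_le hb.le]
    exact h.continuousOn.norm.pow 2
  have cv : ContinuousOn (fun x => ‖v x‖ ^ 2) (uIcc 0 b) := by
    rw [uIcc_of_le hb.le]
    exact hvc.norm.pow 2
  rw [← intervalIntegral.integral_add cu.intervalIntegrable cv.intervalIntegrable]
  refine intervalIntegral.integral_mono_on hb.le (cu.add cv).intervalIntegrable
    cr.intervalIntegrable fun x hx => ?_
  have := hμ x hx
  nlinarith [sq_nonneg ‖u x‖]

variable (hb : 0 < b) (hV : ContinuousOn V (Icc 0 b))

/-- The normalized Neumann eigenfunctions, as functions. -/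
def eigenFun (t : samplingPoints V b (Real.pi / 2)) (x : ℝ) : ℂ :=
  ((‖xiL2 hb hV t‖⁻¹ : ℝ) : ℂ) * xi V b x t

theorem coeFn_eigenL2 (t : samplingPoints V b (Real.pi / 2)) :
    eigenL2 hb hV t =ᵐ[volume.restrict (Ioo 0 b)] eigenFun hb hV t := by
  filter_upwards [coeFn_xiL2 hb hV t, Lp.coeFn_smul ((‖xiL2 hb hV t‖⁻¹ : ℝ) : ℂ) (xiL2 hb hV t)]
    with x h1 h2
  rw [eigenL2, h2, Pi.smul_apply, h1, smul_eq_mul, eigenFun]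

theorem continuousOn_eigenFun (t : samplingPoints V b (Real.pi / 2)) :
    ContinuousOn (eigenFun hb hV t) (Icc 0 b) :=
  continuousOn_const.mul (xi_spec hb hV t).1.continuousOn_left

theorem eigenL2_mem_graph (t : samplingPoints V b (Real.pi / 2)) :
    (eigenL2 hb hV t, (t : ℂ) • eigenL2 hb hV t) ∈ schrodingerGraph V b (Real.pi / 2) := by
  have := Submodule.smul_mem _ ((‖xiL2 hb hV t‖⁻¹ : ℝ) : ℂ)
    (xiL2_mem_graph hb hV ((mem_samplingPoints_neumann hb hV).1 t.2))
  rwa [Prod.smul_mk, smul_comm] at this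

include hb hV

/-- For a normalized eigenfunction the energy estimate reads `1 + ∫ ‖v‖² ≤ t - μ`. -/
theorem add_one_le_re (hμ : ∀ x ∈ Icc 0 b, μ + 1 ≤ V x)
    (t : samplingPoints V b (Real.pi / 2)) : μ + 1 ≤ (t : ℂ).re := by
  obtain ⟨u, v, g, h1, h2, h3, h4, h5⟩ :=
    mem_schrodingerGraph_neumann.1 (eigenL2_mem_graph hb hV t)
  have h6 := energy_le hb hV hμ h1 h2 h3 h4 h5
  have hn : ‖eigenL2 hb hV t‖ = 1 := (orthonormal_eigenL2 hb hV).1 t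
  rw [← norm_sq_eq_intervalIntegral hb.le h1] at h6
  simp only [← sub_smul, inner_smul_right, inner_self_eq_norm_sq_to_K, hn] at h6
  have h7 : 0 ≤ ∫ y in (0 : ℝ)..b, ‖v y‖ ^ 2 :=
    intervalIntegral.integral_nonneg hb.le fun _ _ => by positivity
  simp at h6
  linarith

/-- Test with the combination `u` of the `e_t` with coefficients `conj (e_t x)/(t - μ)`. Both its
value at `x` and its energy equal the sum `Q`, so the Sobolev and energy estimates give `Q² ≤ (2/b +
2b) Q`. The bound depends neither on `x` nor on `S`. -/
theorem sum_norm_eigenFun_sq_le (hμ : ∀ x ∈ Icc 0 b, μ + 1 ≤ V x) {x : ℝ} (hx : x ∈ Icc 0 b)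
    (S : Finset (samplingPoints V b (Real.pi / 2))) :
    ∑ t ∈ S, ‖eigenFun hb hV t x‖ ^ 2 / ((t : ℂ).re - μ) ≤ 2 / b + 2 * b := by
  set Q := ∑ t ∈ S, ‖eigenFun hb hV t x‖ ^ 2 / ((t : ℂ).re - μ) with hQ
  have hpos : ∀ t : samplingPoints V b (Real.pi / 2), 0 < (t : ℂ).re - μ := fun t => by
    linarith [add_one_le_re hb hV hμ t]
  set c : samplingPoints V b (Real.pi / 2) → ℂ :=
    fun t => conj (eigenFun hb hV t x) / (((t : ℂ).re - μ : ℝ) : ℂ) with hc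
  have hp := Submodule.sum_mem (schrodingerGraph V b (Real.pi / 2)) (t := S)
    (f := fun t => c t • (eigenL2 hb hV t, (t : ℂ) • eigenL2 hb hV t))
    fun t _ => Submodule.smul_mem _ _ (eigenL2_mem_graph hb hV t)
  obtain ⟨u, v, g, h1, h2, h3, h4, h5⟩ := mem_schrodingerGraph_neumann.1 hp
  have h6 := energy_le hb hV hμ h1 h2 h3 h4 h5
  have hd : HasDensityOn b u v :=
    hasDensityOn_of_hasDerivWithinAt h3.hasDeriv h3.hasDensityOn.continuousOn
  have h7 := norm_sq_le_sobolev hb hd h3.hasDensityOn.continuousOn hx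
  simp only [Prod.fst_sum, Prod.snd_sum, Prod.smul_fst, Prod.smul_snd] at h1 h6
  have e1 : ∑ t ∈ S, c t • (t : ℂ) • eigenL2 hb hV t -
      (μ : ℂ) • ∑ t ∈ S, c t • eigenL2 hb hV t =
      ∑ t ∈ S, (c t * (((t : ℂ).re - μ : ℝ) : ℂ)) • eigenL2 hb hV t := by
    rw [Finset.smul_sum, ← Finset.sum_sub_distrib]
    refine Finset.sum_congr rfl fun t _ => ?_
    have : (((t : ℂ).re : ℝ) : ℂ) = t :=
      Complex.conj_eq_iff_re.1 (conj_eq_of_mem_samplingPoints hb hV t.2)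
    rw [Complex.ofReal_sub, this]
    module
  have hnn : ∀ w : ℂ, w * conj w = ((‖w‖ ^ 2 : ℝ) : ℂ) := fun w => by
    rw [Complex.mul_conj']
    push_cast
    rfl
  have e2 : (inner ℂ (∑ t ∈ S, c t • eigenL2 hb hV t)
      (∑ t ∈ S, (c t * (((t : ℂ).re - μ : ℝ) : ℂ)) • eigenL2 hb hV t)) = (Q : ℂ) := by
    rw [(orthonormal_eigenL2 hb hV).inner_sum, hQ, Complex.ofReal_sum]
    refine Finset.sum_congr rfl fun t _ => ?_
    have h0 : (((t : ℂ).re - μ : ℝ) : ℂ) ≠ 0 := Complex.ofReal_ne_zero.2 (hpos t).ne'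
    rw [Complex.ofReal_div, ← hnn, hc]
    simp only [map_div₀, Complex.conj_conj, Complex.conj_ofReal]
    field_simp
  have e3 : u x = (Q : ℂ) := by
    have ha : (∑ t ∈ S, c t • eigenL2 hb hV t : L2Space b) =ᵐ[volume.restrict (Ioo 0 b)]
        fun x => ∑ t ∈ S, c t * eigenFun hb hV t x := by
      have h8 : ∀ t ∈ S, (c t • eigenL2 hb hV t : L2Space b) =ᵐ[volume.restrict (Ioo 0 b)]
          fun x => c t * eigenFun hb hV t x := fun t _ => by
        filter_upwards [Lp.coeFn_smul (c t) (eigenL2 hb hV t), coeFn_eigenL2 hb hV t] with x a3 a4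
        rw [a3, Pi.smul_apply, a4, smul_eq_mul]
      filter_upwards [Lp.coeFn_fun_finsetSum S fun t => c t • eigenL2 hb hV t,
        (eventually_all_finset S).2 h8] with x a1 a2
      rw [a1]
      exact Finset.sum_congr rfl a2
    have he := eqOn_of_ae_eq hb h3.continuousOn
      (continuousOn_finsetSum S fun t _ =>
        continuousOn_const.mul (continuousOn_eigenFun hb hV t)) (h1.symm.trans ha) hx
    rw [he, hQ, Complex.ofReal_sum]
    refine Finset.sum_congr rfl fun t _ => ?_
    change c t * eigenFun hb hV t x = _
    rw [Complex.ofReal_div, ← hnn, hc]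
    ring
  rw [e1, e2, Complex.ofReal_re] at h6
  have hQ0 : 0 ≤ Q := Finset.sum_nonneg fun t _ => div_nonneg (sq_nonneg _) (hpos t).le
  rw [e3, Complex.norm_real, Real.norm_of_nonneg hQ0] at h7
  have hC : 0 < 2 / b + 2 * b := by positivity
  have h8 : Q ^ 2 ≤ (2 / b + 2 * b) * Q := h7.trans (mul_le_mul_of_nonneg_left h6 hC.le)
  rcases hQ0.eq_or_lt with h9 | h9
  · rw [← h9]
    exact hC.le
  · rw [sq] at h8
    exact le_of_mul_le_mul_right h8 h9

theorem summable_norm_eigenFun_sq (hμ : ∀ x ∈ Icc 0 b, μ + 1 ≤ V x) {x : ℝ}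
    (hx : x ∈ Icc 0 b) :
    Summable fun t : samplingPoints V b (Real.pi / 2) =>
      ‖eigenFun hb hV t x‖ ^ 2 / ((t : ℂ).re - μ) := by
  refine summable_of_sum_le (fun t => ?_) (sum_norm_eigenFun_sq_le hb hV hμ hx)
  have := add_one_le_re hb hV hμ t
  exact div_nonneg (sq_nonneg _) (by linarith)

/-- The resolvent is of trace class. -/
theorem summable_inv_re_sub (hμ : ∀ x ∈ Icc 0 b, μ + 1 ≤ V x) :
    Summable fun t : samplingPoints V b (Real.pi / 2) => 1 / ((t : ℂ).re - μ) := by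
  have hpos : ∀ t : samplingPoints V b (Real.pi / 2), 0 < (t : ℂ).re - μ := fun t => by
    linarith [add_one_le_re hb hV hμ t]
  refine summable_of_sum_le (c := b * (2 / b + 2 * b)) (fun t => (one_div_pos.2 (hpos t)).le)
    fun S => ?_
  have hi : ∀ t ∈ S, IntervalIntegrable
      (fun x => ‖eigenFun hb hV t x‖ ^ 2 / ((t : ℂ).re - μ)) volume 0 b := by
    intro t _
    refine ContinuousOn.intervalIntegrable ?_
    rw [uIcc_of_le hb.le]
    exact ((continuousOn_eigenFun hb hV t).norm.pow 2).div_const _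
  -- Each `e_t` has norm one, so the trace is the integral of the diagonal of the Green function.
  have e : ∑ t ∈ S, 1 / ((t : ℂ).re - μ) =
      ∫ x in (0 : ℝ)..b, ∑ t ∈ S, ‖eigenFun hb hV t x‖ ^ 2 / ((t : ℂ).re - μ) := by
    rw [intervalIntegral.integral_finsetSum hi]
    refine Finset.sum_congr rfl fun t _ => ?_
    rw [intervalIntegral.integral_div,
      ← norm_sq_eq_intervalIntegral hb.le (coeFn_eigenL2 hb hV t),
      (orthonormal_eigenL2 hb hV).1 t, one_pow]
  rw [e]
  have h := intervalIntegral.integral_mono_on hb.le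
    (IntervalIntegrable.sum S (f := fun t x =>
      ‖eigenFun hb hV t x‖ ^ 2 / ((t : ℂ).re - μ)) hi) intervalIntegrable_const
    (g := fun _ => 2 / b + 2 * b)
    (fun x hx => by simpa using sum_norm_eigenFun_sq_le hb hV hμ hx S)
  rw [intervalIntegral.integral_const, sub_zero, smul_eq_mul] at h
  simpa using h

end Energy
end

/-! ### Decay of the cut-off kernel along the spectrum -/

noncomputable section

section KernelBound

variable {V : ℝ → ℝ} {a b μ : ℝ} {t : ℂ}

/-- Green's formula on a subinterval, as an estimate. -/
theorem IsClassicalSolution.norm_integral_mul_le (hV : ContinuousOn V (Icc 0 b))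
    {F F' F'' q q' : ℝ → ℂ} (hF : ∀ x ∈ Icc 0 b, HasDerivWithinAt F (F' x) (Icc 0 b) x)
    (hF' : ∀ x ∈ Icc 0 b, HasDerivWithinAt F' (F'' x) (Icc 0 b) x)
    (hF'' : ContinuousOn F'' (Icc 0 b)) (hq : IsClassicalSolution V b t q q') {K : ℝ}
    (hK : ∀ x ∈ Icc 0 b, ‖((V x : ℂ) - μ) * F x - F'' x‖ ≤ K) {x y : ℝ} (hx : x ∈ Icc 0 b)
    (hy : y ∈ Icc 0 b) (hxy : x ≤ y) :
    ‖(t - μ) * (∫ s in x..y, F s * q s) +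
      ((F y * q' y - F' y * q y) - (F x * q' x - F' x * q x))‖ ≤
      K * ∫ s in (0 : ℝ)..b, ‖q s‖ := by
  have hF'c : ContinuousOn F' (Icc 0 b) := fun x hx => (hF' x hx).continuousWithinAt
  have hFc : ContinuousOn F (Icc 0 b) := fun x hx => (hF x hx).continuousWithinAt
  have hK0 : 0 ≤ K := (norm_nonneg _).trans (hK x hx)
  have hd := (HasDensityOn.deriv_mul hF hF'c (hq.hasDensityOn_right hV)).add
    ((HasDensityOn.deriv_mul hF' hF'' hq.hasDensityOn_left).const_mul (-1))
  have e1 := hd.sub_eq hx hy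
  have hFq : IntegrableOn (fun s => F s * q s) (Icc 0 b) :=
    (hFc.mul hq.continuousOn_left).integrableOn_Icc
  -- Replace `(t - μ) q` by `-q'' + (V - μ) q` and integrate by parts twice. The boundary terms stay
  -- inside the norm so that those from adjacent intervals can cancel.
  have e2 : (t - μ) * (∫ s in x..y, F s * q s) +
      ((F y * q' y - F' y * q y) - (F x * q' x - F' x * q x)) =
      ∫ s in x..y, (((V s : ℂ) - μ) * F s - F'' s) * q s := by
    have : (F y * q' y - F' y * q y) - (F x * q' x - F' x * q x) =
        (F y * q' y + -1 * (F' y * q y)) - (F x * q' x + -1 * (F' x * q x)) := by ring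
    rw [this, e1, ← intervalIntegral.integral_const_mul, ← intervalIntegral.integral_add
      ((intervalIntegrable_of_integrableOn_Icc hFq hx hy).const_mul _)
      (hd.intervalIntegrable hx hy)]
    congr 1
    funext s
    ring
  have hqi : IntegrableOn (fun s => ‖q s‖) (Icc 0 b) :=
    hq.continuousOn_left.norm.integrableOn_Icc
  have h0 : (0 : ℝ) ∈ Icc 0 b := ⟨le_rfl, hx.1.trans hx.2⟩
  have hb' : b ∈ Icc 0 b := ⟨hx.1.trans hx.2, le_rfl⟩
  rw [e2]
  calc ‖∫ s in x..y, (((V s : ℂ) - μ) * F s - F'' s) * q s‖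
      ≤ ∫ s in x..y, K * ‖q s‖ := by
        refine intervalIntegral.norm_integral_le_of_norm_le hxy
          (Eventually.of_forall fun s hs => ?_)
          ((intervalIntegrable_of_integrableOn_Icc hqi hx hy).const_mul _)
        rw [norm_mul]
        exact mul_le_mul_of_nonneg_right (hK s ⟨hx.1.trans hs.1.le, hs.2.trans hy.2⟩)
          (norm_nonneg _)
    _ ≤ K * ∫ s in (0 : ℝ)..b, ‖q s‖ := by
        rw [intervalIntegral.integral_const_mul]
        refine mul_le_mul_of_nonneg_left ?_ hK0
        exact intervalIntegral.integral_mono_interval hx.1 hxy hy.2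
          (Eventually.of_forall fun _ => norm_nonneg _)
          (intervalIntegrable_of_integrableOn_Icc hqi h0 hb')

theorem continuous_cutoff (hab : a < b) : Continuous (cutoff a b) := by
  have : cutoff a b = fun x => min 1 ((b - x) / (b - a)) := by
    funext x
    have h : 0 < b - a := sub_pos.2 hab
    by_cases hx : x ≤ a
    · rw [cutoff, if_pos hx, min_eq_left]
      rw [one_le_div h]
      linarith
    · rw [cutoff, if_neg hx, min_eq_right]
      rw [div_le_one h]
      linarith [not_le.1 hx]
  rw [this]
  fun_prop

theorem continuousOn_cutoff_mul (hab : a < b) {q : ℝ → ℂ} (hq : ContinuousOn q (Icc 0 b)) :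
    ContinuousOn (fun x => (cutoff a b x : ℂ) * q x) (Icc 0 b) :=
  (Complex.continuous_ofReal.comp (continuous_cutoff hab)).continuousOn.mul hq

theorem innerL2_cutoff (ha : 0 < a) (hab : a < b) {P q : ℝ → ℂ} (hP : ContinuousOn P (Icc 0 b))
    (hq : ContinuousOn q (Icc 0 b)) :
    innerL2 b P (fun x => (cutoff a b x : ℂ) * q x) =
      (∫ x in (0 : ℝ)..a, conj (P x) * q x) +
        ∫ x in a..b, (((b - x) / (b - a) : ℝ) : ℂ) * conj (P x) * q x := by
  have hb : 0 < b := ha.trans hab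
  have hc : ContinuousOn (fun x => conj (P x) * ((cutoff a b x : ℂ) * q x)) (Icc 0 b) :=
    (Complex.continuous_conj.comp_continuousOn hP).mul (continuousOn_cutoff_mul hab hq)
  have h0 : (0 : ℝ) ∈ Icc 0 b := ⟨le_rfl, hb.le⟩
  have hb' : b ∈ Icc 0 b := ⟨hb.le, le_rfl⟩
  have ha' : a ∈ Icc 0 b := ⟨ha.le, hab.le⟩
  rw [innerL2, ← integral_Ioc_eq_integral_Ioo, ← intervalIntegral.integral_of_le hb.le,
    ← intervalIntegral.integral_add_adjacent_intervals
      (intervalIntegrable_of_integrableOn_Icc hc.integrableOn_Icc h0 ha')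
      (intervalIntegrable_of_integrableOn_Icc hc.integrableOn_Icc ha' hb')]
  congr 1
  · refine intervalIntegral.integral_congr fun x hx => ?_
    rw [uIcc_of_le ha.le] at hx
    simp only [cutoff, if_pos hx.2, Complex.ofReal_one, one_mul]
  · refine intervalIntegral.integral_congr_ae (Eventually.of_forall fun x hx => ?_)
    rw [uIoc_of_le hab.le] at hx
    simp only [cutoff, if_neg (not_le.2 hx.1)]
    ring

variable (hb : 0 < b) (hV : ContinuousOn V (Icc 0 b))

theorem integral_norm_xi_le (t : ℂ) :
    ∫ s in (0 : ℝ)..b, ‖xi V b s t‖ ≤ Real.sqrt b * ‖xiL2 hb hV t‖ := by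
  have h1 := sq_integral_le hb (xi_spec hb hV t).1.continuousOn_left.norm
  rw [← norm_sq_eq_intervalIntegral hb.le (coeFn_xiL2 hb hV t)] at h1
  have h2 : Real.sqrt b * ‖xiL2 hb hV t‖ = Real.sqrt (b * ‖xiL2 hb hV t‖ ^ 2) := by
    rw [Real.sqrt_mul hb.le, Real.sqrt_sq (norm_nonneg _)]
  rw [h2]
  exact Real.le_sqrt_of_sq_le h1

/-- The decay of the cut-off kernel along the spectrum. -/
theorem exists_innerL2_cutoff_bound (ha : 0 < a) (hab : a < b) (hμ : ∀ x ∈ Icc 0 b, μ + 1 ≤ V x)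
    (ρ : ℝ) : ∃ C, 0 < C ∧ ∀ w : ℂ, ‖w‖ ≤ ρ → ∀ t : samplingPoints V b (Real.pi / 2),
      ‖innerL2 b (fun x => xi V b x w) (fun x => (cutoff a b x : ℂ) * xi V b x t)‖ *
        ((t : ℂ).re - μ) ≤
      C * (‖xi V b a t‖ + ‖xi V b b t‖ + ‖xiL2 hb hV t‖) := by
  obtain ⟨C₀, hC₀, hbd⟩ := exists_xi_bound hb hV ρ
  have hba : 0 < b - a := sub_pos.2 hab
  have h0 : (0 : ℝ) ∈ Icc 0 b := ⟨le_rfl, hb.le⟩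
  have hb' : b ∈ Icc 0 b := ⟨hb.le, le_rfl⟩
  have ha' : a ∈ Icc 0 b := ⟨ha.le, hab.le⟩
  -- These bound `(V - μ) F - F''` for `F = P`, where it is `(conj w - μ) P`, and for `F = l P`,
  -- where the product rule adds `-2 m P'`. The factor `b / (b - a)` bounds `l` on all of `[0,b]`.
  set K₁ := (|ρ| + |μ|) * C₀ with hK₁
  set K₂ := (|ρ| + |μ|) * (b / (b - a)) * C₀ + 2 / (b - a) * C₀ with hK₂
  have hK₁0 : 0 ≤ K₁ := by positivity
  have hK₂0 : 0 ≤ K₂ := by positivity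
  refine ⟨C₀ / (b - a) + (K₁ + K₂) * Real.sqrt b, by positivity, fun w hw t => ?_⟩
  obtain ⟨hp, hp0, hp0'⟩ := xi_spec hb hV w
  obtain ⟨hq, hq0, hq0'⟩ := xi_spec hb hV t
  have hqb := (mem_samplingPoints_neumann hb hV).1 t.2
  have htμ : (((t : ℂ).re : ℝ) : ℂ) = t :=
    Complex.conj_eq_iff_re.1 (conj_eq_of_mem_samplingPoints hb hV t.2)
  set P : ℝ → ℂ := fun x => conj (xi V b x w) with hP
  set P' : ℝ → ℂ := fun x => conj (xiDeriv V b x w) with hP'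
  set P'' : ℝ → ℂ := fun x => ((V x : ℂ) - conj w) * P x with hP''
  set q : ℝ → ℂ := fun x => xi V b x t with hqdef
  set q' : ℝ → ℂ := fun x => xiDeriv V b x t with hq'def
  have dP : ∀ x ∈ Icc 0 b, HasDerivWithinAt P (P' x) (Icc 0 b) x := fun x hx =>
    (Complex.conjCLE : ℂ →L[ℝ] ℂ).hasFDerivAt.comp_hasDerivWithinAt x (hp.deriv_left x hx)
  have dP' : ∀ x ∈ Icc 0 b, HasDerivWithinAt P' (P'' x) (Icc 0 b) x := fun x hx => by
    refine ((Complex.conjCLE : ℂ →L[ℝ] ℂ).hasFDerivAt.comp_hasDerivWithinAt x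
      (hp.deriv_right x hx)).congr_deriv ?_
    simp [hP'', hP]
  have hVC : ContinuousOn (fun x => (V x : ℂ) - conj w) (Icc 0 b) :=
    (Complex.continuous_ofReal.comp_continuousOn hV).sub continuousOn_const
  have cP : ContinuousOn P (Icc 0 b) := fun x hx => (dP x hx).continuousWithinAt
  have cP' : ContinuousOn P' (Icc 0 b) := fun x hx => (dP' x hx).continuousWithinAt
  have cP'' : ContinuousOn P'' (Icc 0 b) := hVC.mul cP
  have nP : ∀ x ∈ Icc 0 b, ‖P x‖ ≤ C₀ := fun x hx => by
    simpa [hP] using (hbd w hw x hx).1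
  have nP' : ∀ x ∈ Icc 0 b, ‖P' x‖ ≤ C₀ := fun x hx => by
    simpa [hP'] using (hbd w hw x hx).2
  have nw : ‖conj w - (μ : ℂ)‖ ≤ |ρ| + |μ| := by
    refine (norm_sub_le _ _).trans ?_
    rw [RCLike.norm_conj, Complex.norm_real, Real.norm_eq_abs]
    gcongr
    exact hw.trans (le_abs_self ρ)
  set l : ℝ → ℂ := fun x => (((b - x) / (b - a) : ℝ) : ℂ) with hl
  set m : ℂ := ((-1 / (b - a) : ℝ) : ℂ) with hm
  have dl : ∀ x, HasDerivWithinAt l m (Icc 0 b) x := fun x =>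
    ((((hasDerivAt_id x).const_sub b).div_const (b - a)).ofReal_comp).hasDerivWithinAt
  have cl : ContinuousOn l (Icc 0 b) := fun x _ => (dl x).continuousWithinAt
  have dF : ∀ x ∈ Icc 0 b,
      HasDerivWithinAt (fun x => l x * P x) (m * P x + l x * P' x) (Icc 0 b) x :=
    fun x hx => (dl x).mul (dP x hx)
  have dF' : ∀ x ∈ Icc 0 b, HasDerivWithinAt (fun x => m * P x + l x * P' x)
      (m * P' x + (m * P' x + l x * P'' x)) (Icc 0 b) x :=
    fun x hx => ((dP x hx).const_mul m).add ((dl x).mul (dP' x hx))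
  have cF'' : ContinuousOn (fun x => m * P' x + (m * P' x + l x * P'' x)) (Icc 0 b) :=
    (continuousOn_const.mul cP').add ((continuousOn_const.mul cP').add (cl.mul cP''))
  have b1 := hq.norm_integral_mul_le (μ := μ) hV dP dP' cP'' (K := K₁) (fun x hx => by
    have : ((V x : ℂ) - μ) * P x - P'' x = (conj w - μ) * P x := by
      simp only [hP'']
      ring
    rw [this, norm_mul]
    exact mul_le_mul nw (nP x hx) (norm_nonneg _) (by positivity)) h0 ha' ha.le
  have b2 := hq.norm_integral_mul_le (μ := μ) hV dF dF' cF'' (K := K₂) (fun x hx => by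
    have : ((V x : ℂ) - μ) * (l x * P x) - (m * P' x + (m * P' x + l x * P'' x)) =
        (conj w - μ) * l x * P x - 2 * m * P' x := by
      simp only [hP'']
      ring
    rw [this]
    refine (norm_sub_le _ _).trans ?_
    have nl : ‖l x‖ ≤ b / (b - a) := by
      simp only [hl]
      rw [Complex.norm_real, Real.norm_of_nonneg (div_nonneg (by linarith [hx.2]) hba.le)]
      gcongr
      linarith [hx.1]
    have nm : ‖2 * m‖ = 2 / (b - a) := by
      rw [norm_mul, hm, Complex.norm_real, norm_div, norm_neg, norm_one, Real.norm_of_nonneg hba.le]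
      simp
      ring
    rw [norm_mul, norm_mul, norm_mul (2 * m), nm]
    have := nP x hx
    have := nP' x hx
    simp only [hK₂]
    gcongr) ha' hb' hab.le
  rw [innerL2_cutoff ha hab hp.continuousOn_left hq.continuousOn_left]
  set I₁ := ∫ s in (0 : ℝ)..a, P s * q s with hI₁
  set I₂ := ∫ s in a..b, l s * P s * q s with hI₂
  have hq0'' : q' 0 = 0 := hq0'
  have hqb'' : q' b = 0 := hqb
  have hP0'' : P' 0 = 0 := by simp [hP', hp0']
  have hlb : l b = 0 := by simp [hl]
  have hla : l a = 1 := by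
    simp only [hl]
    rw [div_self hba.ne', Complex.ofReal_one]
  have hmn : ‖m‖ = 1 / (b - a) := by
    rw [hm, Complex.norm_real, norm_div, norm_neg, norm_one, Real.norm_of_nonneg hba.le]
  rw [hq0'', hP0'', mul_zero, zero_mul, sub_zero, sub_zero] at b1
  rw [hqb'', hlb, hla] at b2
  have hint := integral_norm_xi_le hb hV t
  have hgap : 0 < (t : ℂ).re - μ := by linarith [add_one_le_re hb hV hμ t]
  -- The terms with `q' a` and with `P' a` cancel since `l a = 1`. What is left comes from the jumps
  -- `m` and `-m` of the slope of the cutoff at `a` and `b`.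
  have hcomb : ((t : ℂ) - μ) * (I₁ + I₂) = (((t : ℂ) - μ) * I₁ + (P a * q' a - P' a * q a)) +
      (((t : ℂ) - μ) * I₂ + (0 * P b * 0 - (m * P b + 0 * P' b) * q b -
        (1 * P a * q' a - (m * P a + 1 * P' a) * q a))) + m * (P b * q b - P a * q a) := by
    ring
  have hn : ‖((t : ℂ) - μ) * (I₁ + I₂)‖ = ‖I₁ + I₂‖ * ((t : ℂ).re - μ) := by
    rw [norm_mul, ← htμ, ← Complex.ofReal_sub, Complex.norm_real, Complex.ofReal_re,
      Real.norm_of_nonneg hgap.le, mul_comm]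
  rw [← hn, hcomb]
  have b3 : ‖m * (P b * q b - P a * q a)‖ ≤ C₀ / (b - a) * (‖q a‖ + ‖q b‖) := by
    rw [norm_mul, hmn]
    have h1 : ‖P b * q b - P a * q a‖ ≤ C₀ * ‖q b‖ + C₀ * ‖q a‖ := by
      refine (norm_sub_le _ _).trans ?_
      rw [norm_mul, norm_mul]
      have := nP b hb'
      have := nP a ha'
      gcongr
    calc 1 / (b - a) * ‖P b * q b - P a * q a‖ ≤ 1 / (b - a) * (C₀ * ‖q b‖ + C₀ * ‖q a‖) := by
          gcongr
      _ = _ := by ring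
  refine (norm_add₃_le).trans ?_
  have h5 : (K₁ + K₂) * ∫ s in (0 : ℝ)..b, ‖q s‖ ≤ (K₁ + K₂) * (Real.sqrt b * ‖xiL2 hb hV t‖) :=
    mul_le_mul_of_nonneg_left hint (by positivity)
  have h6 : 0 ≤ C₀ / (b - a) * ‖xiL2 hb hV t‖ := by positivity
  have h7 : 0 ≤ (K₁ + K₂) * Real.sqrt b * (‖q a‖ + ‖q b‖) := by positivity
  linarith

end KernelBound
end

/-! ### Weights, the sampling formula and the perturbed series -/

noncomputable section

variable {V : ℝ → ℝ} {a b μ : ℝ}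

/-- The extension by zero of an element of `L²(0,a)`. -/
theorem exists_extension (hab : a ≤ b) (φ : L2Space a) :
    ∃ Φ : L2Space b, ∀ (ψ : L2Space b) (h : ℝ → ℂ), ψ =ᵐ[volume.restrict (Ioo 0 b)] h →
      inner ℂ ψ Φ = innerL2 a h φ := by
  have hm : MemLp ((Ioo 0 a).indicator φ) 2 (volume.restrict (Ioo 0 b)) := by
    rw [memLp_indicator_iff_restrict measurableSet_Ioo, Measure.restrict_restrict measurableSet_Ioo,
      inter_eq_left.2 (Ioo_subset_Ioo_right hab)]
    exact Lp.memLp φ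
  refine ⟨hm.toLp _, fun ψ h hψ => ?_⟩
  rw [← innerL2_eq_inner, innerL2, innerL2]
  have e : (∫ x in Ioo 0 b, conj (ψ x) * (hm.toLp _ : L2Space b) x) =
      ∫ x in Ioo 0 b, (Ioo 0 a).indicator (fun x => conj (h x) * φ x) x := by
    refine integral_congr_ae ?_
    filter_upwards [hψ, hm.coeFn_toLp] with x h1 h2
    rw [h1, h2]
    by_cases hx : x ∈ Ioo 0 a
    · simp [hx]
    · simp [hx]
  rw [e, integral_indicator measurableSet_Ioo, Measure.restrict_restrict measurableSet_Ioo,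
    inter_eq_left.2 (Ioo_subset_Ioo_right hab)]

variable (hb : 0 < b) (hV : ContinuousOn V (Icc 0 b))
include hb hV

/-- Points of the spectrum are real, so `k_b(t,t)` is the squared norm of `ξ(·,t)`. -/
theorem modifiedKernel_eq (z : ℂ) (t : samplingPoints V b (Real.pi / 2)) :
    modifiedKernel V a b z t = (((‖xiL2 hb hV t‖ ^ 2)⁻¹ : ℝ) : ℂ) *
      innerL2 b (fun x => xi V b x (conj z)) (fun x => (cutoff a b x : ℂ) * xi V b x t) := by
  have h := inner_eq_intervalIntegral hb.le (coeFn_xiL2 hb hV t) (coeFn_xiL2 hb hV t)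
  rw [inner_self_eq_norm_sq_to_K, intervalIntegral.integral_of_le hb.le,
    integral_Ioc_eq_integral_Ioo] at h
  rw [modifiedKernel, reproducingKernel, conj_eq_of_mem_samplingPoints hb hV t.2, innerL2, ← h,
    one_div]
  push_cast
  rfl

/-- The weights in the Weierstrass test. -/
theorem exists_summable_kernel_bound (ha : 0 < a) (hab : a < b)
    (hμ : ∀ x ∈ Icc 0 b, μ + 1 ≤ V x) (ρ : ℝ) :
    ∃ s : samplingPoints V b (Real.pi / 2) → ℝ, Summable s ∧ ∀ z : ℂ, ‖z‖ ≤ ρ →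
      ∀ t : samplingPoints V b (Real.pi / 2), ‖modifiedKernel V a b z t‖ ≤ s t ∧
        ‖modifiedKernel V a b z t‖ * ‖xiL2 hb hV t‖ ≤ s t := by
  obtain ⟨C, hC, hbd⟩ := exists_innerL2_cutoff_bound hb hV ha hab hμ ρ
  have h0 : (0 : ℝ) ∈ Icc 0 b := ⟨le_rfl, hb.le⟩
  have hb' : b ∈ Icc 0 b := ⟨hb.le, le_rfl⟩
  have ha' : a ∈ Icc 0 b := ⟨ha.le, hab.le⟩
  -- With `A = |e_t(a)|`, `B = |e_t(b)|` and `N⁻¹ = |e_t(0)|`, the quantities to dominate are `(A +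
  -- B + 1) N⁻¹` and `A + B + 1`, over `t - μ`. Completing squares gives this sum. The first
  -- estimate serves bounded data `ε`, the second the samples `f t`, which may grow like `N`.
  refine ⟨fun t => C * (2 * (‖eigenFun hb hV t 0‖ ^ 2 / ((t : ℂ).re - μ)) +
    ‖eigenFun hb hV t a‖ ^ 2 / ((t : ℂ).re - μ) + ‖eigenFun hb hV t b‖ ^ 2 / ((t : ℂ).re - μ) +
    2 * (1 / ((t : ℂ).re - μ))), ?_, fun z hz t => ?_⟩
  · exact (((((summable_norm_eigenFun_sq hb hV hμ h0).mul_left 2).add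
      (summable_norm_eigenFun_sq hb hV hμ ha')).add
      (summable_norm_eigenFun_sq hb hV hμ hb')).add
      ((summable_inv_re_sub hb hV hμ).mul_left 2)).mul_left C
  · have h1 := hbd (conj z) (by rwa [RCLike.norm_conj]) t
    have hgap : 0 < (t : ℂ).re - μ := by linarith [add_one_le_re hb hV hμ t]
    set N := ‖xiL2 hb hV t‖ with hN
    have hN0 : 0 < N := norm_pos_iff.2 (xiL2_ne_zero hb hV t)
    have he : ∀ x, ‖eigenFun hb hV t x‖ = N⁻¹ * ‖xi V b x t‖ := fun x => by
      rw [eigenFun, norm_mul, Complex.norm_real, norm_inv, norm_norm]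
    have he0 : ‖eigenFun hb hV t 0‖ = N⁻¹ := by
      rw [he, (xi_spec hb hV t).2.1, norm_one, mul_one]
    beta_reduce
    rw [he0]
    set A := ‖eigenFun hb hV t a‖ with hA
    set B := ‖eigenFun hb hV t b‖ with hB
    have hxa : ‖xi V b a t‖ = N * A := by rw [hA, he, mul_inv_cancel_left₀ hN0.ne']
    have hxb : ‖xi V b b t‖ = N * B := by rw [hB, he, mul_inv_cancel_left₀ hN0.ne']
    have hA0 : 0 ≤ A := norm_nonneg _
    have hB0 : 0 ≤ B := norm_nonneg _
    rw [hxa, hxb, ← le_div_iff₀ hgap] at h1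
    rw [modifiedKernel_eq hb hV, norm_mul, Complex.norm_real, norm_inv, norm_pow,
      Real.norm_of_nonneg hN0.le]
    set I := ‖innerL2 b (fun x => xi V b x (conj z)) fun x => (cutoff a b x : ℂ) * xi V b x t‖
    have h2 : (N ^ 2)⁻¹ * I * N ≤ C * ((A + B + 1) / ((t : ℂ).re - μ)) := by
      calc (N ^ 2)⁻¹ * I * N ≤
          (N ^ 2)⁻¹ * (C * (N * A + N * B + N) / ((t : ℂ).re - μ)) * N := by gcongr
        _ = _ := by field_simp
    have h3 : (N ^ 2)⁻¹ * I ≤ C * ((A + B + 1) * N⁻¹ / ((t : ℂ).re - μ)) := by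
      calc (N ^ 2)⁻¹ * I = ((N ^ 2)⁻¹ * I * N) * N⁻¹ := by field_simp
        _ ≤ C * ((A + B + 1) / ((t : ℂ).re - μ)) * N⁻¹ := by gcongr
        _ = _ := by ring
    have e : C * (2 * (N⁻¹ ^ 2 / ((t : ℂ).re - μ)) + A ^ 2 / ((t : ℂ).re - μ) +
        B ^ 2 / ((t : ℂ).re - μ) + 2 * (1 / ((t : ℂ).re - μ))) =
        C * ((2 * N⁻¹ ^ 2 + A ^ 2 + B ^ 2 + 2) / ((t : ℂ).re - μ)) := by ring
    rw [e]
    refine ⟨h3.trans ?_, h2.trans ?_⟩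
    · refine mul_le_mul_of_nonneg_left (div_le_div_of_nonneg_right ?_ hgap.le) hC.le
      nlinarith [sq_nonneg (A - N⁻¹), sq_nonneg (B - N⁻¹), sq_nonneg (1 - N⁻¹), sq_nonneg A,
        sq_nonneg B, sq_nonneg N⁻¹]
    · refine mul_le_mul_of_nonneg_left (div_le_div_of_nonneg_right ?_ hgap.le) hC.le
      nlinarith [sq_nonneg (A - 1), sq_nonneg (B - 1), sq_nonneg N⁻¹]

/-- Oversampling: the modified kernel reproduces the elements of the smaller space. -/
theorem exists_bound_and_hasSum (hab : a < b) (hμ : ∀ x ∈ Icc 0 b, μ + 1 ≤ V x)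
    {f : ℂ → ℂ} (hf : f ∈ deBrangesSpace V b a) :
    (∃ M : ℝ, ∀ t : samplingPoints V b (Real.pi / 2), ‖f t‖ ≤ M * ‖xiL2 hb hV t‖) ∧
      ∀ z, HasSum (fun t : samplingPoints V b (Real.pi / 2) => modifiedKernel V a b z t * f t)
        (f z) := by
  obtain ⟨φ, hφ⟩ := hf
  obtain ⟨Φ, hΦ⟩ := exists_extension hab.le φ
  have hft : ∀ t : samplingPoints V b (Real.pi / 2), f t = inner ℂ (xiL2 hb hV t) Φ := fun t => by
    rw [hφ, conj_eq_of_mem_samplingPoints hb hV t.2, hΦ _ _ (coeFn_xiL2 hb hV t)]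
  refine ⟨⟨‖Φ‖, fun t => ?_⟩, fun z => ?_⟩
  · rw [hft, mul_comm]
    exact norm_inner_le_norm _ _
  -- `μ` lies strictly below the spectrum, so the resolvent at `μ` is available.
  · have hμ' : xiDeriv V b b μ ≠ 0 := by
      intro h
      have := add_one_le_re hb hV hμ ⟨_, (mem_samplingPoints_neumann hb hV).2 h⟩
      simp only [Complex.ofReal_re] at this
      linarith
    let B := HilbertBasis.mkOfOrthogonalEqBot (orthonormal_eigenL2 hb hV)
      (span_eigenL2_orthogonal_eq_bot hb hV hμ')
    set p : ℝ → ℂ := fun x => xi V b x (conj z) with hp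
    have cp : ContinuousOn p (Icc 0 b) := (xi_spec hb hV (conj z)).1.continuousOn_left
    -- Parseval's identity with the cutoff on the side of `ξ(·,z̄)`: it modifies the coefficients
    -- into the new kernel but leaves the inner product with `Φ` unchanged, by `e1`.
    have hs := B.hasSum_inner_mul_inner (toL2 _ (continuousOn_cutoff_mul hab cp)) Φ
    have e1 : inner ℂ (toL2 _ (continuousOn_cutoff_mul hab cp)) Φ = f z := by
      rw [hΦ _ _ (coeFn_toL2 _ _), hφ, innerL2, innerL2]
      refine setIntegral_congr_fun measurableSet_Ioo fun x hx => ?_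
      simp only [cutoff, if_pos hx.2.le, Complex.ofReal_one, one_mul, hp]
    rw [e1] at hs
    refine hs.congr_fun fun t => ?_
    have e2 : B t = eigenL2 hb hV t := by
      simp only [B, HilbertBasis.coe_mkOfOrthogonalEqBot]
    have e3 : inner ℂ (toL2 _ (continuousOn_cutoff_mul hab cp)) (xiL2 hb hV t) =
        innerL2 b p (fun x => (cutoff a b x : ℂ) * xi V b x t) := by
      rw [inner_eq_intervalIntegral hb.le (coeFn_toL2 _ _) (coeFn_xiL2 hb hV t), innerL2,
        intervalIntegral.integral_of_le hb.le, integral_Ioc_eq_integral_Ioo]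
      congr 1
      funext x
      rw [map_mul, Complex.conj_ofReal]
      ring
    rw [e2, eigenL2, inner_smul_right, inner_smul_left, Complex.conj_ofReal, e3, ← hft,
      modifiedKernel_eq hb hV]
    push_cast
    ring

end

theorem theorem3p1 (V : ℝ → ℝ) (hV : AbsolutelyContinuousOnInterval V 0 Real.pi)
    (a : ℝ) (ha : a ∈ Set.Ioo 0 Real.pi) (K : Set ℂ) (hK : IsCompact K) :
    ∃ C : ℝ, 0 < C ∧
      ∀ f ∈ deBrangesSpace V Real.pi a,
      ∀ ε : lp (fun _ : samplingPoints V Real.pi (Real.pi / 2) => ℂ) ∞,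
        HasSumUniformlyOn
          (fun (t : samplingPoints V Real.pi (Real.pi / 2)) (z : ℂ) =>
            modifiedKernel V a Real.pi z t * (f t + ε t))
          (perturbedSeries V a Real.pi (Real.pi / 2) f ε) K ∧
        ∀ z ∈ K,
          ‖f z - perturbedSeries V a Real.pi (Real.pi / 2) f ε z‖ ≤ C * ‖ε‖ := by
  have hVc : ContinuousOn V (Icc 0 Real.pi) := by
    have := hV.continuousOn
    rwa [uIcc_of_le Real.pi_pos.le] at this
  obtain ⟨M, hM⟩ := isCompact_Icc.exists_bound_of_continuousOn hVc
  -- The choice `μ = -M - 1` puts `μ + 1` below the minimum of `V`.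
  have hμ : ∀ x ∈ Icc 0 Real.pi, (-M - 1) + 1 ≤ V x := fun x hx => by
    linarith [neg_le_of_abs_le (hM x hx)]
  obtain ⟨ρ, hρ⟩ := hK.isBounded.exists_norm_le
  obtain ⟨s, hs, hsb⟩ := exists_summable_kernel_bound Real.pi_pos hVc ha.1 ha.2 hμ ρ
  have hs0 : ∀ z ∈ K, ∀ t, 0 ≤ s t := fun z hz t =>
    (norm_nonneg _).trans (hsb z (hρ z hz) t).1
  -- The sum of the weights is the constant. The absolute value and the `1` give positivity even for
  -- empty `K`, where no sign of `s` is known.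
  refine ⟨|∑' t, s t| + 1, by positivity, fun f hf ε => ?_⟩
  obtain ⟨⟨F, hF⟩, hsum⟩ := exists_bound_and_hasSum Real.pi_pos hVc ha.2 hμ hf
  have hε : ∀ t, ‖ε t‖ ≤ ‖ε‖ := fun t => lp.norm_apply_le_norm ENNReal.top_ne_zero ε t
  have hεb : ∀ z ∈ K, ∀ t : samplingPoints V Real.pi (Real.pi / 2),
      ‖modifiedKernel V a Real.pi z t * ε t‖ ≤ s t * ‖ε‖ := by
    intro z hz t
    rw [norm_mul]
    exact mul_le_mul (hsb z (hρ z hz) t).1 (hε t) (norm_nonneg _) (hs0 z hz t)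
  have hfb : ∀ z ∈ K, ∀ t : samplingPoints V Real.pi (Real.pi / 2),
      ‖modifiedKernel V a Real.pi z t * f t‖ ≤ s t * |F| := by
    intro z hz t
    rw [norm_mul]
    calc ‖modifiedKernel V a Real.pi z t‖ * ‖f t‖
        ≤ ‖modifiedKernel V a Real.pi z t‖ * (|F| * ‖xiL2 Real.pi_pos hVc t‖) := by
          gcongr
          exact (hF t).trans (mul_le_mul_of_nonneg_right (le_abs_self F) (norm_nonneg _))
      _ = (‖modifiedKernel V a Real.pi z t‖ * ‖xiL2 Real.pi_pos hVc t‖) * |F| := by ring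
      _ ≤ s t * |F| := mul_le_mul_of_nonneg_right (hsb z (hρ z hz) t).2 (abs_nonneg _)
  refine ⟨HasSumUniformlyOn.of_norm_le_summable ((hs.mul_right |F|).add (hs.mul_right ‖ε‖))
    fun t z hz => ?_, fun z hz => ?_⟩
  · rw [mul_add]
    exact (norm_add_le _ _).trans (add_le_add (hfb z hz t) (hεb z hz t))
  · have hεs : Summable fun t : samplingPoints V Real.pi (Real.pi / 2) =>
        modifiedKernel V a Real.pi z t * ε t :=
      Summable.of_norm_bounded (hs.mul_right ‖ε‖) (hεb z hz)
    -- The unperturbed part of the series sums to `f z`, so the error consists of the terms with `ε`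
    -- alone and its bound does not involve `f`.
    have e : perturbedSeries V a Real.pi (Real.pi / 2) f ε z =
        f z + ∑' t : samplingPoints V Real.pi (Real.pi / 2),
          modifiedKernel V a Real.pi z t * ε t := by
      rw [perturbedSeries, ← (hsum z).tsum_eq, ← (hsum z).summable.tsum_add hεs]
      simp only [mul_add]
    rw [e, sub_add_cancel_left, norm_neg]
    refine (tsum_of_norm_bounded (hs.mul_right ‖ε‖).hasSum (hεb z hz)).trans ?_
    rw [tsum_mul_right]
    refine mul_le_mul_of_nonneg_right ?_ (norm_nonneg _)
    linarith [le_abs_self (∑' t, s t)]
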